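/- Let $(X,\mathcal A,\mu)$ and $(Y,\mathcal B,\nu)$ be probability spaces, let $\mathcal B_1\subseteq\mathcal B_2\subseteq\cdots$ be $\sigma$-subalgebras of $\mathcal A$, and let $\widehat{\mathcal B}_j=\mathcal B_j\otimes\mathcal B$ be the $\sigma$-algebra on $X\times Y$ generated by the sets $A\times B$ with $A\in\mathcal B_j$, $B\in\mathcal B$. Let $\widehat{\mathcal B}_\infty$ be the $\sigma$-algebra generated by $\bigcup_j\widehat{\mathcal B}_j$. Functions are real- or complex-valued. Let $1\le p<\infty$, and for measurable $F$ on $X\times Y$ put $$N_p(F)(x)=\Big(\int_Y|F(x,y)|^p\,d\nu(y)\Big)^{1/p}\in[0,\infty],\qquad \|F\|_{1,p}=\int_X N_p(F)\,d\mu .$$ Conditional expectations on $X\times Y$ are taken with respect to $\mu\times\nu$. (1) Let $1\le p<\infty$ and $\|F\|_{1,p}<\infty$. Then $F\in L^1(X\times Y)$, and $F_j=E(F\mid\widehat{\mathcal B}_j)$ satisfies $N_p(F_j)\le E(N_p(F)\mid\mathcal B_j)$ almost everywhere on $X$ and $\|F_j\|_{1,p}\le\|F\|_{1,p}$ for each $j$.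 With $F_\infty=E(F\mid\widehat{\mathcal B}_\infty)$ one has $\|F_j-F_\infty\|_{1,p}\to0$, and $F_j(x,\cdot)\to F_\infty(x,\cdot)$ in $L^p(Y)$ for almost every $x\in X$. If $F$ is equal almost everywhere to a $\widehat{\mathcal B}_\infty$-measurable function, then both convergences hold with $F$ in place of $F_\infty$. (2) Let $1\le p<\infty$ and let $(F_j)$ be a martingale on $X\times Y$ with respect to $(\widehat{\mathcal B}_j)$ with $\|F_j\|_{1,p}<\infty$ for each $j$. Then $(N_p(F_j))$ is a submartingale with respect to $(\mathcal B_j)$ (in particular $N_p(F_j)\le E(N_p(F_{j+1})\mid\mathcal B_j)$ almost everywhere), and $t\,\mu(\{x:\sup_jN_p(F_j)(x)>t\})\le\sup_j\|F_j\|_{1,p}$ for every $t\ge0$. (3) Let $1<p<\infty$ and let $(F_j)$ be a martingale with respect to $(\widehat{\mathcal B}_j)$ such that $\|F_j\|_{1,p}$ is bounded in $j$ and $(N_p(F_j))$ is uniformly integrable on $X$. Then $(F_j)$ is uniformly integrable on $X\times Y$, and there is a measurable $F$ on $X\times Y$ with $\|F\|_{1,p}<\infty$ such that $F_j=E(F\mid\widehat{\mathcal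 B}_j)$ for each $j$, $F_j\to F$ in $L^1(X\times Y)$ and almost everywhere, $\|F_j-F\|_{1,p}\to0$, and $F_j(x,\cdot)\to F(x,\cdot)$ in $L^p(Y)$ for almost every $x\in X$. (4) Let $1<p<\infty$ and let $(F_j)$ be a martingale with respect to $(\widehat{\mathcal B}_j)$ such that $\int_XN_p(F_j)\,d\mu\le C$ for some $C\ge 0$ and all $j$. Then $(F_j(x,\cdot))$ converges in $L^p(Y)$ for almost every $x\in X$. (5) Let $1\le p<\infty$, and for each $l\ge1$ let $(f_{j,l})_{j\ge1}$ be a martingale on $X$ with respect to $(\mathcal B_j)$. Put $\|f_j(x)\|_p=\big(\sum_{l\ge1}|f_{j,l}(x)|^p\big)^{1/p}$ and suppose that $\int_X\|f_j\|_p\,d\mu$ is bounded in $j$. Then $(\|f_j\|_p)$ is a submartingale with respect to $(\mathcal B_j)$; $t\,\mu(\{x:\sup_j\|f_j(x)\|_p>t\})\le\sup_j\int_X\|f_j\|_p\,d\mu$ for every $t\ge0$; for every $\eta>0$ there is an $n$ such that $\int_X\big(\sum_{l>n}|f_{j,l}|^p\big)^{1/p}d\mu\le\eta$ for all $j$; and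 $f_j(x)=(f_{j,l}(x))_{l\ge1}$ converges in $\ell^p$ for almost every $x\in X$. -/

import Mathlib

open MeasureTheory Filter Topology
open scoped ENNReal NNReal

noncomputable section

/-- The filtration `ℬ̂_j = ℬ_j ⊗ 𝓑` on `X × Y`, with `ℬ_j` on `X` and the whole
`σ`-algebra of `Y` on `Y`. -/
def prodFiltration {X Y : Type*} {mX : MeasurableSpace X} [mY : MeasurableSpace Y]
    (ℱ : Filtration ℕ mX) :
    Filtration ℕ (Prod.instMeasurableSpace : MeasurableSpace (X × Y)) where
  seq j := (ℱ j).prod mY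
  mono' _ _ hij := sup_le_sup (MeasurableSpace.comap_mono (ℱ.mono hij)) le_rfl
  le' _ := sup_le_sup (MeasurableSpace.comap_mono (ℱ.le _)) le_rfl

/-- `N_p(F)(x) = (∫_Y |F(x, y)|^p dν(y))^{1/p}`, with values in `[0, ∞]`
(for `0 < p < ∞`). -/
def sliceNorm {X Y 𝕜 : Type*} [RCLike 𝕜] [MeasurableSpace Y]
    (p : ℝ≥0∞) (ν : Measure Y) (F : X × Y → 𝕜) (x : X) : ℝ≥0∞ :=
  eLpNorm (fun y => F (x, y)) p ν

/-- The mixed norm `∫_X N_p(F) dμ`, with values in `[0, ∞]`. -/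
def mixedNorm {X Y 𝕜 : Type*} [RCLike 𝕜] [MeasurableSpace X] [MeasurableSpace Y]
    (p : ℝ≥0∞) (μ : Measure X) (ν : Measure Y) (F : X × Y → 𝕜) : ℝ≥0∞ :=
  ∫⁻ x, sliceNorm p ν F x ∂μ

/-- The functions `u_j` and `g` are in `L^p(ν)`, and `u_j → g` in `L^p(ν)`. -/
def TendstoInLp {Y 𝕜 : Type*} [RCLike 𝕜] [MeasurableSpace Y]
    (p : ℝ≥0∞) (ν : Measure Y) (u : ℕ → Y → 𝕜) (g : Y → 𝕜) : Prop :=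
  (∀ j, MemLp (u j) p ν) ∧ MemLp g p ν ∧
    Tendsto (fun j => eLpNorm (fun y => u j y - g y) p ν) atTop (𝓝 0)

/-- The `ℓ^p` norm `(∑_l |a_l|^p)^{1/p}` of a scalar sequence, with values in `[0, ∞]`
(for `0 < p < ∞`). -/
def seqNorm {𝕜 : Type*} [RCLike 𝕜] (p : ℝ≥0∞) (a : ℕ → 𝕜) : ℝ≥0∞ :=
  (∑' l, ‖a l‖ₑ ^ p.toReal) ^ (1 / p.toReal)

/-- The sequences `u_j` and `g` are in `ℓ^p`, and `u_j → g` in `ℓ^p`. -/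
def TendstoInSeqLp {𝕜 : Type*} [RCLike 𝕜] (p : ℝ≥0∞) (u : ℕ → ℕ → 𝕜) (g : ℕ → 𝕜) : Prop :=
  (∀ j, Memℓp (u j) p) ∧ Memℓp g p ∧
    Tendsto (fun j => seqNorm p (fun l => u j l - g l)) atTop (𝓝 0)

end

/-! The engine is a conditional Minkowski inequality: conditioning on `m ⊗ 𝓑`, with the whole
σ-algebra of `Y` retained, contracts slice norms in the sense `N_p(E(F | m ⊗ 𝓑)) ≤ E(N_p(F) | m)`.
It follows by duality: the extremal weight for the slice norm of the conditional expectation is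
itself `m ⊗ 𝓑`-measurable, so it can be tested against `F`, and Hölder on each slice finishes
(`setLIntegral_rpow_le_of_forall_setLIntegral_le`). Hence slice norms of martingales are
submartingales, and Doob's argument gives the weak-type bound `mul_measure_iSup_le`.

For a closed martingale, bounded functions are dense in the mixed norm. They obey Lévy's theorem
with dominated convergence on slices; the contraction transfers norm convergence to general `F`, and
the maximal inequality transfers convergence almost everywhere.

If `p > 1`, uniform integrability of the slice norms forces that of the martingale: slices with
bounded `L^p` norm have small integral above a high level. The martingale is then closed by its
limit, which has finite mixed norm by Fatou, and the closed case applies. If the mixed norms are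
merely bounded, stopping when the slice norm first exceeds `n` gives a martingale whose slice norms
have an integrable majorant. It agrees with the original where the slice norms stay at most `n`, and
these sets exhaust `X` up to a null set.

For sequences the range `p = 1` is included because tails are controlled directly. Minkowski's
integral inequality bounds `(∫ head)^p + (∫ tail)^p` by the `p`-th power of the supremum of the
integrals. A head that once nearly attains this supremum keeps doing so, since its norm is a
submartingale; so the later tails are small, and the earlier ones are smaller still. The maximal
inequality turns this into pointwise smallness of tails, and coordinates converge by the scalar
theorem. -/

/-! ### Conditional Minkowski inequality by duality -/

/-- Integrals over sets of a sub-`σ`-algebra control integrals of its measurable weights. -/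
theorem lintegral_mul_le_of_forall_setLIntegral_le {Ω : Type*} {m m0 : MeasurableSpace Ω}
    (hm : m ≤ m0) {P : Measure Ω} {G F h : Ω → ℝ≥0∞} (hG : Measurable G) (hF : Measurable F)
    (hGF : ∀ S, MeasurableSet[m] S → ∫⁻ z in S, G z ∂P ≤ ∫⁻ z in S, F z ∂P)
    (hh : Measurable[m] h) : ∫⁻ z, G z * h z ∂P ≤ ∫⁻ z, F z * h z ∂P := by
  have hh0 : Measurable h := hh.mono hm le_rfl
  -- The hypothesis is an inequality between density measures restricted to `m`; every
  -- `m`-measurable weight then integrates monotonically.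
  have key : (P.withDensity G).trim hm ≤ (P.withDensity F).trim hm := by
    refine @Measure.le_intro _ m _ _ fun S hS _ => ?_
    rw [trim_measurableSet_eq hm hS, trim_measurableSet_eq hm hS, withDensity_apply _ (hm _ hS),
      withDensity_apply _ (hm _ hS)]
    exact hGF S hS
  have e : ∀ K : Ω → ℝ≥0∞, Measurable K →
      ∫⁻ z, K z * h z ∂P = ∫⁻ z, h z ∂((P.withDensity K).trim hm) := by
    intro K hK
    rw [lintegral_trim hm hh, lintegral_withDensity_eq_lintegral_mul _ hK hh0]
    rfl
  rw [e G hG, e F hF]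
  exact @lintegral_mono' _ m _ _ key _ _ le_rfl

/-- The dual weight `g ^ (p - 1) / ‖g‖_p ^ (p - 1)` recovers the norm of `g`. -/
theorem lintegral_rpow_le_lintegral_mul_weight {Y : Type*} [MeasurableSpace Y] {ν : Measure Y}
    {p : ℝ} (hp : 1 ≤ p) {g : Y → ℝ≥0∞} (hg : Measurable g) (hg_top : ∫⁻ y, g y ^ p ∂ν ≠ ∞) :
    (∫⁻ y, g y ^ p ∂ν) ^ (1 / p) ≤
      ∫⁻ y, g y * (g y ^ (p - 1) * (((∫⁻ y, g y ^ p ∂ν) ^ (1 / p)) ^ (p - 1))⁻¹) ∂ν := by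
  have hp0 : 0 < p := by linarith
  set I := ∫⁻ y, g y ^ p ∂ν with hI
  have h1 : ∫⁻ y, g y * (g y ^ (p - 1) * ((I ^ (1 / p)) ^ (p - 1))⁻¹) ∂ν
      = I * ((I ^ (1 / p)) ^ (p - 1))⁻¹ := by
    rw [hI, ← lintegral_mul_const _ (hg.pow_const _), ← hI]
    refine lintegral_congr fun y => ?_
    rw [← mul_assoc]
    congr 1
    nth_rewrite 1 [← ENNReal.rpow_one (g y)]
    rw [← ENNReal.rpow_add_of_nonneg _ _ zero_le_one (by linarith)]
    congr 1; ring
  rw [h1]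
  rcases eq_or_ne I 0 with h0 | h0
  · simp [h0, hp0]
  · rw [← ENNReal.rpow_mul, ← ENNReal.rpow_neg]
    nth_rewrite 2 [← ENNReal.rpow_one I]
    rw [← ENNReal.rpow_add _ _ h0 hg_top]
    refine le_of_eq ?_
    congr 1
    field_simp
    ring

/-- Hölder's inequality against the dual weight of `g`. -/
theorem lintegral_mul_weight_le {Y : Type*} [MeasurableSpace Y] {ν : Measure Y}
    {p : ℝ} (hp : 1 ≤ p) {f g : Y → ℝ≥0∞} (hf : Measurable f) (hg : Measurable g)
    (hg_top : ∫⁻ y, g y ^ p ∂ν ≠ ∞) :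
    ∫⁻ y, f y * (g y ^ (p - 1) * (((∫⁻ y, g y ^ p ∂ν) ^ (1 / p)) ^ (p - 1))⁻¹) ∂ν ≤
      (∫⁻ y, f y ^ p ∂ν) ^ (1 / p) := by
  set I := ∫⁻ y, g y ^ p ∂ν with hI
  rcases hp.eq_or_lt with rfl | hp1
  · simp
  have hpq := Real.HolderConjugate.conjExponent hp1
  have hp0 : 0 < p := by linarith
  rcases eq_or_ne I 0 with h0 | h0
  -- Here the normalising factor is `0⁻¹ = ∞`, but `g` vanishes almost everywhere and `p > 1`, so
  -- the weight is `0 * ∞ = 0`.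
  · have : ∀ᵐ y ∂ν, g y = 0 := by
      have := (lintegral_eq_zero_iff (hg.pow_const p)).1 h0
      filter_upwards [this] with y hy
      simpa [hp0, hp0.not_gt] using hy
    have : ∫⁻ y, f y * (g y ^ (p - 1) * ((I ^ (1 / p)) ^ (p - 1))⁻¹) ∂ν = 0 := by
      rw [← lintegral_zero (μ := ν)]
      refine lintegral_congr_ae ?_
      filter_upwards [this] with y hy
      simp [hy, hp1]
    rw [this]; exact zero_le
  have hc : (I ^ (1 / p)) ^ (p - 1) = I ^ (1 / Real.conjExponent p) := by
    rw [← ENNReal.rpow_mul]; congr 1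
    rw [Real.conjExponent]; field_simp
  have hc0 : I ^ (1 / Real.conjExponent p) ≠ 0 := by
    simp [h0, hg_top]
  have hct : I ^ (1 / Real.conjExponent p) ≠ ∞ := by
    refine ENNReal.rpow_ne_top_of_nonneg ?_ hg_top
    exact one_div_nonneg.2 hpq.symm.nonneg
  calc ∫⁻ y, f y * (g y ^ (p - 1) * ((I ^ (1 / p)) ^ (p - 1))⁻¹) ∂ν
      = (∫⁻ y, f y * g y ^ (p - 1) ∂ν) * ((I ^ (1 / p)) ^ (p - 1))⁻¹ := by
        have := lintegral_mul_const (μ := ν) ((I ^ (1 / p)) ^ (p - 1))⁻¹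
          (f := fun y => f y * g y ^ (p - 1)) (hf.mul (hg.pow_const _))
        rw [← this]
        simp_rw [mul_assoc]
    _ ≤ ((∫⁻ y, f y ^ p ∂ν) ^ (1 / p) * I ^ (1 / Real.conjExponent p)) *
          (I ^ (1 / Real.conjExponent p))⁻¹ := by
        rw [hc]
        gcongr
        exact ENNReal.lintegral_mul_rpow_le_lintegral_rpow_mul_lintegral_rpow hpq
          hf.aemeasurable hg.aemeasurable
    _ = (∫⁻ y, f y ^ p ∂ν) ^ (1 / p) := by
        rw [mul_assoc, ENNReal.mul_inv_cancel hc0 hct, mul_one]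

theorem MeasurableSpace.prod_mono_left {X Y : Type*} {m mX : MeasurableSpace X}
    (mY : MeasurableSpace Y) (hm : m ≤ mX) : m.prod mY ≤ mX.prod mY :=
  sup_le_sup (MeasurableSpace.comap_mono hm) le_rfl

/-- A conditional Minkowski inequality: domination of the integrals over the sets of `m ⊗ mY` passes
to the mixed `L^1(L^p)` integrals over the sets of `m`. -/
theorem setLIntegral_rpow_le_of_forall_setLIntegral_le {X Y : Type*} {m mX : MeasurableSpace X}
    [mY : MeasurableSpace Y] (hm : m ≤ mX) {μ : Measure X} [SFinite μ] {ν : Measure Y}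
    [SigmaFinite ν] {p : ℝ} (hp : 1 ≤ p) {G F : X × Y → ℝ≥0∞} (hG : Measurable[m.prod mY] G)
    (hF : Measurable F)
    (hGF : ∀ S, MeasurableSet[m.prod mY] S →
      ∫⁻ z in S, G z ∂(μ.prod ν) ≤ ∫⁻ z in S, F z ∂(μ.prod ν))
    {A : Set X} (hA : MeasurableSet[m] A) :
    ∫⁻ x in A, (∫⁻ y, G (x, y) ^ p ∂ν) ^ (1 / p) ∂μ ≤
      ∫⁻ x in A, (∫⁻ y, F (x, y) ^ p ∂ν) ^ (1 / p) ∂μ := by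
  have hp0 : 0 < p := by linarith
  have hmm : m.prod mY ≤ mX.prod mY := MeasurableSpace.prod_mono_left mY hm
  -- Truncation in height and to sets of finite measure makes every slice norm finite, as the dual
  -- weight requires; monotone convergence recovers `G`.
  set K : ℕ → X × Y → ℝ≥0∞ := fun n z =>
    (spanningSets ν n).indicator (fun _ => min (G z) n) z.2 with hK
  have hKm : ∀ n, Measurable[m.prod mY] (K n) := by
    intro n
    have : K n = (Prod.snd ⁻¹' spanningSets ν n).indicator (fun z => min (G z) n) := by
      rfl
    rw [this]
    refine Measurable.indicator (hG.min measurable_const) ?_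
    exact (@measurable_snd _ _ m mY) (measurableSet_spanningSets ν n)
  have hKmono : ∀ z, Monotone fun n => K n z := by
    intro z i j hij
    refine (Set.indicator_le_indicator_of_subset (monotone_spanningSets ν hij)
      (fun _ => zero_le) z.2).trans ?_
    refine Set.indicator_le_indicator ?_
    exact min_le_min le_rfl (by exact_mod_cast hij)
  have hKG : ∀ n z, K n z ≤ G z := by
    intro n z
    refine Set.indicator_le' (fun _ _ => min_le_left _ _) (fun _ _ => zero_le) z.2
  have hKsup : ∀ z, ⨆ n, K n z = G z := by
    intro z
    refine le_antisymm (iSup_le fun n => hKG n z) ?_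
    refine le_of_forall_lt fun c hc => ?_
    obtain ⟨n1, hn1⟩ := ENNReal.exists_nat_gt (ne_top_of_lt hc)
    obtain ⟨n2, hn2⟩ : ∃ n, z.2 ∈ spanningSets ν n :=
      Set.mem_iUnion.1 ((iUnion_spanningSets ν).symm ▸ Set.mem_univ z.2)
    refine lt_of_lt_of_le ?_ (le_iSup _ (max n1 n2))
    have : z.2 ∈ spanningSets ν (max n1 n2) := monotone_spanningSets ν (le_max_right _ _) hn2
    simp only [hK, Set.indicator_of_mem this, lt_min_iff]
    exact ⟨hc, hn1.trans_le (by exact_mod_cast le_max_left _ _)⟩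
  have hK_top : ∀ n x, ∫⁻ y, K n (x, y) ^ p ∂ν ≠ ∞ := by
    intro n x
    refine ne_top_of_le_ne_top (b := (n : ℝ≥0∞) ^ p * ν (spanningSets ν n)) ?_ ?_
    · exact ENNReal.mul_ne_top (ENNReal.rpow_ne_top_of_nonneg hp0.le (by simp))
        (measure_spanningSets_lt_top ν n).ne
    · rw [← lintegral_indicator_const (measurableSet_spanningSets ν n)]
      refine lintegral_mono fun y => ?_
      by_cases hy : y ∈ spanningSets ν n
      · simp only [hK, Set.indicator_of_mem hy]
        exact ENNReal.rpow_le_rpow (min_le_right _ _) hp0.le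
      · simp [hK, hy, hp0]
  have hKm' : ∀ n x, Measurable fun y => K n (x, y) := fun n x =>
    ((hKm n).mono hmm le_rfl).comp measurable_prodMk_left
  have hF' : ∀ x, Measurable fun y => F (x, y) := fun x => hF.comp measurable_prodMk_left
  set a : ℕ → X → ℝ≥0∞ := fun n x => (∫⁻ y, K n (x, y) ^ p ∂ν) ^ (1 / p) with ha
  have ham : ∀ n, Measurable[m] (a n) := by
    intro n
    refine Measurable.pow_const ?_ _
    exact @Measurable.lintegral_prod_right' _ _ m mY _ _ _ ((hKm n).pow_const p)
  have step : ∀ n, ∫⁻ x in A, a n x ∂μ ≤ ∫⁻ x in A, (∫⁻ y, F (x, y) ^ p ∂ν) ^ (1 / p) ∂μ := by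
    intro n
    -- The weight is dual to the slices of `K n`, localised to `A`, and is measurable for `m ⊗ mY`.
    -- Against `K n ≤ G` it returns the norm of `K n`; against `F` Hölder bounds it by the norm of
    -- `F`.
    set h : X × Y → ℝ≥0∞ := fun z => A.indicator (fun _ => K n z ^ (p - 1) * (a n z.1 ^ (p - 1))⁻¹)
      z.1 with hh
    have hhm : Measurable[m.prod mY] h := by
      have : h = (Prod.fst ⁻¹' A).indicator (fun z => K n z ^ (p - 1) * (a n z.1 ^ (p - 1))⁻¹) := by
        rfl
      rw [this]
      refine Measurable.indicator ?_ ((@measurable_fst _ _ m mY) hA)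
      exact ((hKm n).pow_const _).mul
        ((((ham n).comp (@measurable_fst _ _ m mY)).pow_const _).inv)
    have hhm0 : Measurable h := hhm.mono hmm le_rfl
    have hG0 : Measurable G := hG.mono hmm le_rfl
    have key := lintegral_mul_le_of_forall_setLIntegral_le hmm hG0 hF hGF hhm
    rw [lintegral_prod (fun z => G z * h z) (hG0.mul hhm0).aemeasurable,
      lintegral_prod (fun z => F z * h z) (hF.mul hhm0).aemeasurable] at key
    rw [← lintegral_indicator (hm _ hA), ← lintegral_indicator (hm _ hA)]
    refine le_trans (lintegral_mono fun x => ?_) (key.trans (lintegral_mono fun x => ?_))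
    · by_cases hx : x ∈ A
      · simp only [hh, Set.indicator_of_mem hx]
        refine (lintegral_rpow_le_lintegral_mul_weight hp (hKm' n x) (hK_top n x)).trans ?_
        exact lintegral_mono fun y => mul_le_mul_left (hKG n _) _
      · simp [hx]
    · by_cases hx : x ∈ A
      · simp only [hh, Set.indicator_of_mem hx]
        exact lintegral_mul_weight_le hp (hF' x) (hKm' n x) (hK_top n x)
      · simp [hx, hh]
  have hsup : ∀ x, (∫⁻ y, G (x, y) ^ p ∂ν) ^ (1 / p) = ⨆ n, a n x := by
    intro x
    have : ∀ y, G (x, y) ^ p = ⨆ n, K n (x, y) ^ p := by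
      intro y
      rw [← hKsup]
      exact (ENNReal.orderIsoRpow p hp0).map_iSup _
    simp_rw [this]
    rw [lintegral_iSup (fun n => (hKm' n x).pow_const p)
      (fun i j hij y => ENNReal.rpow_le_rpow (hKmono _ hij) hp0.le)]
    exact (ENNReal.orderIsoRpow (1 / p) (by positivity)).map_iSup _
  simp_rw [hsup]
  rw [lintegral_iSup (fun n => (ham n).mono hm le_rfl)]
  · exact iSup_le step
  · intro i j hij x
    exact ENNReal.rpow_le_rpow (lintegral_mono fun y =>
      ENNReal.rpow_le_rpow (hKmono _ hij) hp0.le) (by positivity)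

/-! ### From `[0, ∞]`-valued set integrals to real conditional expectations -/

theorem setIntegral_toReal_le_of_setLIntegral_le {Ω : Type*} {m0 : MeasurableSpace Ω}
    {μ : Measure Ω} {g h : Ω → ℝ≥0∞} (hg : Measurable g) (hh : Measurable h)
    (hh_top : ∫⁻ x, h x ∂μ ≠ ∞) {A : Set Ω}
    (hgh : ∫⁻ x in A, g x ∂μ ≤ ∫⁻ x in A, h x ∂μ) :
    ∫ x in A, (g x).toReal ∂μ ≤ ∫ x in A, (h x).toReal ∂μ := by
  have hhA : ∫⁻ x in A, h x ∂μ ≠ ∞ := ne_top_of_le_ne_top hh_top (setLIntegral_le_lintegral _ _)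
  have hgA : ∫⁻ x in A, g x ∂μ ≠ ∞ := ne_top_of_le_ne_top hhA hgh
  rw [integral_toReal hg.aemeasurable (ae_lt_top hg hgA),
    integral_toReal hh.aemeasurable (ae_lt_top hh hhA)]
  exact ENNReal.toReal_mono hhA hgh

/-- Both sides are `m`-measurable, so comparing integrals over sets of `m` suffices; there the
conditional expectation integrates to the same value as `h`. Passing to `toReal` loses nothing
because `h` is finite almost everywhere. -/
theorem ae_le_ofReal_condExp_toReal {Ω : Type*} {m m0 : MeasurableSpace Ω} (hm : m ≤ m0)
    {μ : Measure Ω} [IsFiniteMeasure μ] {g h : Ω → ℝ≥0∞} (hg : Measurable[m] g)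
    (hh : Measurable h) (hh_top : ∫⁻ x, h x ∂μ ≠ ∞)
    (hgh : ∀ A, MeasurableSet[m] A → ∫⁻ x in A, g x ∂μ ≤ ∫⁻ x in A, h x ∂μ) :
    ∀ᵐ x ∂μ, g x ≤ ENNReal.ofReal ((μ[fun x => (h x).toReal | m]) x) := by
  have hint : Integrable (fun x => (h x).toReal) μ :=
    integrable_toReal_of_lintegral_ne_top hh.aemeasurable hh_top
  set c := μ[fun x => (h x).toReal | m] with hc
  have hcm : StronglyMeasurable[m] c := stronglyMeasurable_condExp
  have hc0 : 0 ≤ᵐ[μ] c := condExp_nonneg (ae_of_all _ fun x => ENNReal.toReal_nonneg)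
  have hcm' : Measurable[m] fun x => ENNReal.ofReal (c x) := hcm.measurable.ennreal_ofReal
  refine ae_le_of_ae_le_trim (hm := hm) (f₂ := fun x => ENNReal.ofReal (c x)) ?_
  refine @ae_le_of_forall_setLIntegral_le_of_sigmaFinite _ m _ _ _ _ hg fun A hA _ => ?_
  rw [← lintegral_indicator hA, ← lintegral_indicator hA,
    lintegral_trim hm (hg.indicator hA), lintegral_trim hm (hcm'.indicator hA),
    lintegral_indicator (hm _ hA), lintegral_indicator (hm _ hA)]
  refine (hgh A hA).trans (le_of_eq ?_)
  rw [← ofReal_integral_eq_lintegral_ofReal integrable_condExp.integrableOn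
    (ae_restrict_of_ae hc0), setIntegral_condExp hm hint hA,
    ofReal_integral_eq_lintegral_ofReal hint.integrableOn
      (ae_of_all _ fun x => ENNReal.toReal_nonneg)]
  refine lintegral_congr_ae (ae_restrict_of_ae ?_)
  filter_upwards [ae_lt_top hh hh_top] with x hx
  rw [ENNReal.ofReal_toReal hx.ne]

/-! ### Submartingales with values in `[0, ∞]` and the maximal inequality -/

/-- An adapted process with values in `[0, ∞]` whose integrals over the sets of the past
increase. -/
structure IsSubmartingaleENNReal {Ω : Type*} {m0 : MeasurableSpace Ω} (N : ℕ → Ω → ℝ≥0∞)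
    (ℱ : Filtration ℕ m0) (μ : Measure Ω) : Prop where
  measurable : ∀ j, Measurable[ℱ j] (N j)
  setLIntegral_le : ∀ i j, i ≤ j → ∀ A, MeasurableSet[ℱ i] A →
    ∫⁻ x in A, N i x ∂μ ≤ ∫⁻ x in A, N j x ∂μ

namespace IsSubmartingaleENNReal

variable {Ω : Type*} {m0 : MeasurableSpace Ω} {N : ℕ → Ω → ℝ≥0∞} {ℱ : Filtration ℕ m0}
  {μ : Measure Ω}

theorem measurable' (hN : IsSubmartingaleENNReal N ℱ μ) (j : ℕ) : Measurable (N j) :=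
  (hN.measurable j).mono (ℱ.le j) le_rfl

theorem lintegral_mono (hN : IsSubmartingaleENNReal N ℱ μ) {i j : ℕ} (hij : i ≤ j) :
    ∫⁻ x, N i x ∂μ ≤ ∫⁻ x, N j x ∂μ := by
  simpa using hN.setLIntegral_le i j hij Set.univ MeasurableSet.univ

theorem submartingale_toReal [IsFiniteMeasure μ] (hN : IsSubmartingaleENNReal N ℱ μ)
    (hN_top : ∀ j, ∫⁻ x, N j x ∂μ ≠ ∞) : Submartingale (fun j x => (N j x).toReal) ℱ μ := by
  refine submartingale_of_setIntegral_le (fun j => ?_) (fun j => ?_) fun i j hij A hA => ?_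
  · exact (hN.measurable j).ennreal_toReal.stronglyMeasurable
  · exact integrable_toReal_of_lintegral_ne_top (hN.measurable' j).aemeasurable (hN_top j)
  · exact setIntegral_toReal_le_of_setLIntegral_le (hN.measurable' i) (hN.measurable' j) (hN_top j)
      (hN.setLIntegral_le i j hij A hA)

/-- The event that the process exceeds the level `t` for the first time at time `i`. -/
def firstExceed (N : ℕ → Ω → ℝ≥0∞) (t : ℝ≥0∞) (i : ℕ) : Set Ω :=
  {x | t < N i x ∧ ∀ k < i, N k x ≤ t}

theorem measurableSet_firstExceed (hN : IsSubmartingaleENNReal N ℱ μ) (t : ℝ≥0∞) (i : ℕ) :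
    MeasurableSet[ℱ i] (firstExceed N t i) := by
  have : firstExceed N t i = N i ⁻¹' Set.Ioi t ∩ ⋂ k, ⋂ (_ : k < i), N k ⁻¹' Set.Iic t := by
    ext x; simp [firstExceed]
  rw [this]
  refine MeasurableSet.inter (hN.measurable i measurableSet_Ioi) ?_
  exact MeasurableSet.iInter fun k => MeasurableSet.iInter fun hk =>
    ℱ.mono hk.le _ (hN.measurable k measurableSet_Iic)

theorem disjoint_firstExceed (N : ℕ → Ω → ℝ≥0∞) (t : ℝ≥0∞) :
    Pairwise (Function.onFun Disjoint (firstExceed N t)) := by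
  intro i j hij
  refine Set.disjoint_left.2 fun x hi hj => ?_
  rcases lt_or_gt_of_ne hij with h | h
  · exact (hj.2 i h).not_gt hi.1
  · exact (hi.2 j h).not_gt hj.1

/-- The event of first exceeding at time `i < n` belongs to `ℱ i`, so `N i` may be replaced by `N n`
there, and the events are disjoint. This is stronger than the maximal inequality alone: it also
makes the process at its first exceedance integrable, as stopping requires. -/
theorem tsum_setLIntegral_firstExceed_le (hN : IsSubmartingaleENNReal N ℱ μ) (t : ℝ≥0∞) :
    ∑' i, ∫⁻ x in firstExceed N t i, N i x ∂μ ≤ ⨆ j, ∫⁻ x, N j x ∂μ := by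
  rw [ENNReal.tsum_eq_iSup_nat]
  refine iSup_le fun n => ?_
  refine le_trans ?_ (le_iSup _ n)
  have h0 : ∀ i, MeasurableSet (firstExceed N t i) := fun i =>
    ℱ.le i _ (hN.measurableSet_firstExceed t i)
  calc ∑ i ∈ Finset.range n, ∫⁻ x in firstExceed N t i, N i x ∂μ
      ≤ ∑ i ∈ Finset.range n, ∫⁻ x in firstExceed N t i, N n x ∂μ :=
        Finset.sum_le_sum fun i hi => hN.setLIntegral_le i n (Finset.mem_range.1 hi).le _
          (hN.measurableSet_firstExceed t i)
    _ ≤ ∑' i, ∫⁻ x in firstExceed N t i, N n x ∂μ := ENNReal.sum_le_tsum _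
    _ = ∫⁻ x in ⋃ i, firstExceed N t i, N n x ∂μ :=
        (lintegral_iUnion h0 (disjoint_firstExceed N t) _).symm
    _ ≤ ∫⁻ x, N n x ∂μ := setLIntegral_le_lintegral _ _

theorem iUnion_firstExceed (N : ℕ → Ω → ℝ≥0∞) (t : ℝ≥0∞) :
    ⋃ i, firstExceed N t i = {x | t < ⨆ j, N j x} := by
  classical
  ext x
  simp only [Set.mem_iUnion, Set.mem_ofPred_eq, lt_iSup_iff]
  refine ⟨fun ⟨i, hi⟩ => ⟨i, hi.1⟩, fun h => ⟨Nat.find h, Nat.find_spec h, fun k hk => ?_⟩⟩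
  exact not_lt.1 (Nat.find_min h hk)

/-- Doob's maximal inequality. -/
theorem mul_measure_iSup_le (hN : IsSubmartingaleENNReal N ℱ μ) (t : ℝ≥0∞) :
    t * μ {x | t < ⨆ j, N j x} ≤ ⨆ j, ∫⁻ x, N j x ∂μ := by
  have h0 : ∀ i, MeasurableSet (firstExceed N t i) := fun i =>
    ℱ.le i _ (hN.measurableSet_firstExceed t i)
  refine le_trans ?_ (hN.tsum_setLIntegral_firstExceed_le t)
  rw [← iUnion_firstExceed, measure_iUnion (disjoint_firstExceed N t) h0, ← ENNReal.tsum_mul_left]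
  refine ENNReal.tsum_le_tsum fun i => ?_
  rw [← setLIntegral_const]
  exact setLIntegral_mono' (h0 i) fun x hx => hx.1.le

theorem ae_iSup_lt_top (hN : IsSubmartingaleENNReal N ℱ μ)
    (hbdd : ⨆ j, ∫⁻ x, N j x ∂μ ≠ ∞) : ∀ᵐ x ∂μ, ⨆ j, N j x < ∞ := by
  have h : ∀ n : ℕ, (n : ℝ≥0∞) * μ {x | ⨆ j, N j x = ∞} ≤ ⨆ j, ∫⁻ x, N j x ∂μ := fun n =>
    le_trans (by gcongr; intro hx; simp [hx]) (hN.mul_measure_iSup_le n)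
  have h0 : μ {x | ⨆ j, N j x = ∞} = 0 := by
    by_contra hne
    obtain ⟨n, hn⟩ := ENNReal.exists_nat_mul_gt hne hbdd
    exact (h n).not_gt hn
  filter_upwards [measure_eq_zero_iff_ae_notMem.1 h0] with x hx
  exact lt_top_iff_ne_top.2 hx

end IsSubmartingaleENNReal

/-! ### Scalar martingales -/

/-- Applied to the real and imaginary parts, this reduces scalar convergence to real martingales. -/
theorem MeasureTheory.Martingale.clm_comp {Ω 𝕜 : Type*} [RCLike 𝕜] {m0 : MeasurableSpace Ω}
    {μ : Measure Ω} {ℱ : Filtration ℕ m0} {f : ℕ → Ω → 𝕜} (hf : Martingale f ℱ μ)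
    (T : 𝕜 →L[ℝ] ℝ) :
    Martingale (fun j x => T (f j x)) ℱ μ := by
  refine ⟨fun j => T.continuous.comp_stronglyMeasurable (hf.1 j), fun i j hij => ?_⟩
  have h := T.comp_condExp_comm (m := ℱ i) (hf.integrable j)
  filter_upwards [h, hf.2 i j hij] with x h1 h2
  rw [← h2]
  exact h1.symm

section Scalar

variable {Ω 𝕜 : Type*} [RCLike 𝕜] {m0 : MeasurableSpace Ω} {μ : Measure Ω} [IsFiniteMeasure μ]
  {ℱ : Filtration ℕ m0}

theorem tendsto_of_re_im {u : ℕ → 𝕜} {a b : ℝ} (ha : Tendsto (fun n => RCLike.re (u n)) atTop (𝓝 a))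
    (hb : Tendsto (fun n => RCLike.im (u n)) atTop (𝓝 b)) :
    Tendsto u atTop (𝓝 ((a : 𝕜) + b * RCLike.I)) := by
  have h := (((RCLike.continuous_ofReal (K := 𝕜)).tendsto a).comp ha).add
    ((((RCLike.continuous_ofReal (K := 𝕜)).tendsto b).comp hb).mul_const RCLike.I)
  refine h.congr fun n => ?_
  simp [RCLike.re_add_im]

theorem ae_exists_tendsto_of_martingale {f : ℕ → Ω → 𝕜} (hf : Martingale f ℱ μ) {R : ℝ≥0}
    (hR : ∀ j, eLpNorm (f j) 1 μ ≤ R) : ∀ᵐ x ∂μ, ∃ c, Tendsto (fun j => f j x) atTop (𝓝 c) := by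
  have h1 := (hf.clm_comp RCLike.reCLM).submartingale.exists_ae_tendsto_of_bdd (R := R) fun j =>
    (eLpNorm_mono fun x => by simpa using RCLike.norm_re_le_norm (f j x)).trans (hR j)
  have h2 := (hf.clm_comp RCLike.imCLM).submartingale.exists_ae_tendsto_of_bdd (R := R) fun j =>
    (eLpNorm_mono fun x => by simpa using RCLike.norm_im_le_norm (f j x)).trans (hR j)
  filter_upwards [h1, h2] with x ⟨a, ha⟩ ⟨b, hb⟩
  exact ⟨_, tendsto_of_re_im ha hb⟩

/-- Lévy's upward theorem for real or complex functions. -/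
theorem tendsto_ae_condExp_rclike {g : Ω → 𝕜} (hg : Integrable g μ) :
    ∀ᵐ x ∂μ, Tendsto (fun n => (μ[g | ℱ n]) x) atTop (𝓝 ((μ[g | ⨆ n, ℱ n]) x)) := by
  have key : ∀ T : 𝕜 →L[ℝ] ℝ, ∀ᵐ x ∂μ,
      Tendsto (fun n => T ((μ[g | ℱ n]) x)) atTop (𝓝 (T ((μ[g | ⨆ n, ℱ n]) x))) := by
    intro T
    have h1 : ∀ᵐ x ∂μ, ∀ n, T ((μ[g | ℱ n]) x) = (μ[T ∘ g | ℱ n]) x :=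
      ae_all_iff.2 fun n => T.comp_condExp_comm hg
    have h2 : ∀ᵐ x ∂μ, T ((μ[g | ⨆ n, ℱ n]) x) = (μ[T ∘ g | ⨆ n, ℱ n]) x :=
      T.comp_condExp_comm hg
    filter_upwards [h1, h2, tendsto_ae_condExp (ℱ := ℱ) (μ := μ) (T ∘ g)] with x h1 h2 h3
    simpa only [h1, h2] using h3
  filter_upwards [key RCLike.reCLM, key RCLike.imCLM] with x h1 h2
  have := tendsto_of_re_im h1 h2
  simpa [RCLike.re_add_im] using this

end Scalar

/-! ### Slice norms and mixed norms -/

theorem setLIntegral_enorm_condExp_le {Ω E : Type*} [NormedAddCommGroup E] [NormedSpace ℝ E]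
    [CompleteSpace E] {m m0 : MeasurableSpace Ω}
    {μ : Measure Ω} {f : Ω → E} (hf : Integrable f μ) {S : Set Ω} (hS : MeasurableSet[m] S) :
    ∫⁻ x in S, ‖(μ[f | m]) x‖ₑ ∂μ ≤ ∫⁻ x in S, ‖f x‖ₑ ∂μ := by
  rw [← ofReal_integral_norm_eq_lintegral_enorm integrable_condExp.integrableOn,
    ← ofReal_integral_norm_eq_lintegral_enorm hf.integrableOn]
  exact ENNReal.ofReal_le_ofReal (setIntegral_norm_condExp_le hS f)

section SliceNorm

variable {X Y 𝕜 : Type*} [RCLike 𝕜] {m mX : MeasurableSpace X} [mY : MeasurableSpace Y]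
  {p : ℝ≥0∞} {μ : Measure X} {ν : Measure Y}

theorem one_le_toReal_exponent (hp : 1 ≤ p) (hp_top : p ≠ ∞) : 1 ≤ p.toReal := by
  simpa using ENNReal.toReal_mono hp_top hp

theorem sliceNorm_eq (hp : 1 ≤ p) (hp_top : p ≠ ∞) (F : X × Y → 𝕜) (x : X) :
    sliceNorm p ν F x = (∫⁻ y, ‖F (x, y)‖ₑ ^ p.toReal ∂ν) ^ (1 / p.toReal) :=
  eLpNorm_eq_lintegral_rpow_enorm_toReal (zero_lt_one.trans_le hp).ne' hp_top

theorem measurable_sliceNorm [SFinite ν] (hp : 1 ≤ p) (hp_top : p ≠ ∞) {F : X × Y → 𝕜}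
    (hF : Measurable F) : Measurable (sliceNorm p ν F) := by
  have : sliceNorm p ν F = fun x => (∫⁻ y, ‖F (x, y)‖ₑ ^ p.toReal ∂ν) ^ (1 / p.toReal) :=
    funext fun x => sliceNorm_eq hp hp_top F x
  rw [this]
  exact (Measurable.lintegral_prod_right' (hF.enorm.pow_const _)).pow_const _

theorem sliceNorm_add_le (hp : 1 ≤ p) {F G : X × Y → 𝕜} (hF : Measurable F) (hG : Measurable G)
    (x : X) : sliceNorm p ν (F + G) x ≤ sliceNorm p ν F x + sliceNorm p ν G x :=
  eLpNorm_add_le (hF.comp measurable_prodMk_left).aestronglyMeasurable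
    (hG.comp measurable_prodMk_left).aestronglyMeasurable hp

theorem sliceNorm_sub_le (hp : 1 ≤ p) {F G : X × Y → 𝕜} (hF : Measurable F) (hG : Measurable G)
    (x : X) : sliceNorm p ν (F - G) x ≤ sliceNorm p ν F x + sliceNorm p ν G x :=
  eLpNorm_sub_le (hF.comp measurable_prodMk_left).aestronglyMeasurable
    (hG.comp measurable_prodMk_left).aestronglyMeasurable hp

theorem sliceNorm_congr_ae [SFinite ν] {F G : X × Y → 𝕜} (h : F =ᵐ[μ.prod ν] G) :
    sliceNorm p ν F =ᵐ[μ] sliceNorm p ν G := by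
  filter_upwards [Measure.ae_ae_of_ae_prod h] with x hx
  exact eLpNorm_congr_ae hx

theorem mixedNorm_congr_ae [SFinite ν] {F G : X × Y → 𝕜} (h : F =ᵐ[μ.prod ν] G) :
    mixedNorm p μ ν F = mixedNorm p μ ν G :=
  lintegral_congr_ae (sliceNorm_congr_ae h)

theorem integrable_of_mixedNorm_lt_top [SFinite μ] [IsProbabilityMeasure ν] (hp : 1 ≤ p)
    {F : X × Y → 𝕜} (hF : Measurable F) (h : mixedNorm p μ ν F < ∞) :
    Integrable F (μ.prod ν) := by
  refine ⟨hF.aestronglyMeasurable, ?_⟩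
  rw [hasFiniteIntegral_iff_enorm, lintegral_prod _ hF.enorm.aemeasurable]
  refine lt_of_le_of_lt (lintegral_mono fun x => ?_) h
  have := eLpNorm_le_eLpNorm_of_exponent_le (μ := ν) hp
    (hF.comp (measurable_prodMk_left (x := x))).aestronglyMeasurable
  rw [eLpNorm_one_eq_lintegral_enorm] at this
  exact this

variable [SFinite μ] [IsFiniteMeasure ν]

theorem setLIntegral_sliceNorm_condExp_le (hm : m ≤ mX) (hp : 1 ≤ p) (hp_top : p ≠ ∞) {F : X × Y → 𝕜} (hF : Measurable F)
    (hint : Integrable F (μ.prod ν)) {A : Set X} (hA : MeasurableSet[m] A) :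
    ∫⁻ x in A, sliceNorm p ν ((μ.prod ν)[F | m.prod mY]) x ∂μ ≤
      ∫⁻ x in A, sliceNorm p ν F x ∂μ := by
  simp_rw [sliceNorm_eq hp hp_top]
  refine setLIntegral_rpow_le_of_forall_setLIntegral_le hm (one_le_toReal_exponent hp hp_top)
    (G := fun z => ‖((μ.prod ν)[F | m.prod mY]) z‖ₑ) (F := fun z => ‖F z‖ₑ) ?_ hF.enorm
    (fun S hS => setLIntegral_enorm_condExp_le hint hS) hA
  exact measurable_enorm.comp (stronglyMeasurable_condExp (m := m.prod mY)).measurable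

theorem mixedNorm_condExp_le (hm : m ≤ mX) (hp : 1 ≤ p) (hp_top : p ≠ ∞) {F : X × Y → 𝕜} (hF : Measurable F)
    (hint : Integrable F (μ.prod ν)) :
    mixedNorm p μ ν ((μ.prod ν)[F | m.prod mY]) ≤ mixedNorm p μ ν F := by
  simpa [mixedNorm] using
    setLIntegral_sliceNorm_condExp_le hm hp hp_top hF hint (A := Set.univ) MeasurableSet.univ

/-- Adaptedness is Tonelli with `ℱ j` as the σ-algebra on `X`; the inequality is conditional
Minkowski, after replacing `F i` by the conditional expectation of `F j` on almost every slice. -/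
theorem isSubmartingaleENNReal_sliceNorm {ℱ : Filtration ℕ mX} (hp : 1 ≤ p) (hp_top : p ≠ ∞)
    {F : ℕ → X × Y → 𝕜} (hF : Martingale F (prodFiltration ℱ) (μ.prod ν)) :
    IsSubmartingaleENNReal (fun j => sliceNorm p ν (F j)) ℱ μ := by
  refine ⟨fun j => ?_, fun i j hij A hA => ?_⟩
  · have h : StronglyMeasurable[(ℱ j).prod mY] (F j) := hF.1 j
    exact @measurable_sliceNorm X Y 𝕜 _ (ℱ j) mY p ν _ hp hp_top _ h.measurable
  · have h : sliceNorm p ν (F i) =ᵐ[μ] sliceNorm p ν ((μ.prod ν)[F j | (ℱ i).prod mY]) :=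
      by
      have h : (μ.prod ν)[F j | (ℱ i).prod mY] =ᵐ[μ.prod ν] F i := hF.2 i j hij
      exact sliceNorm_congr_ae h.symm
    rw [lintegral_congr_ae (ae_restrict_of_ae h)]
    exact setLIntegral_sliceNorm_condExp_le (ℱ.le i) hp hp_top
      ((hF.1 j).mono ((prodFiltration ℱ).le j)).measurable (hF.integrable j) hA

/-- The limit σ-algebra is again of the form `m ⊗ mY`, so conditional Minkowski applies to it too.
-/
theorem iSup_prodFiltration (ℱ : Filtration ℕ mX) :
    ⨆ i, (prodFiltration ℱ : Filtration ℕ (Prod.instMeasurableSpace : MeasurableSpace (X × Y))) i =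
      (⨆ i, ℱ i).prod mY := by
  change ⨆ i, ((ℱ i).comap Prod.fst ⊔ mY.comap Prod.snd) = (⨆ i, ℱ i).comap Prod.fst ⊔ _
  rw [MeasurableSpace.comap_iSup, iSup_sup]

end SliceNorm

/-! ### Dominated convergence and truncation in the mixed norm -/

section CondExp

variable {X Y 𝕜 : Type*} [RCLike 𝕜] {mX : MeasurableSpace X} [mY : MeasurableSpace Y]
  {p : ℝ≥0∞} {μ : Measure X} {ν : Measure Y} [IsProbabilityMeasure ν]

theorem sliceNorm_le_of_bound {F : X × Y → 𝕜} {C : ℝ≥0} {x : X} (h : ∀ᵐ y ∂ν, ‖F (x, y)‖ ≤ C) :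
    sliceNorm p ν F x ≤ C := by
  refine (eLpNorm_le_of_ae_bound h).trans ?_
  simp

/-- Dominated convergence for slice norms. -/
theorem tendsto_sliceNorm_zero_of_bound [IsFiniteMeasure μ] (hp : 1 ≤ p) (hp_top : p ≠ ∞) {D : ℕ → X × Y → 𝕜}
    (hD : ∀ j, Measurable (D j)) {C : ℝ≥0}
    (hb : ∀ j, ∀ᵐ z ∂(μ.prod ν), ‖D j z‖ ≤ C)
    (ht : ∀ᵐ z ∂(μ.prod ν), Tendsto (fun j => D j z) atTop (𝓝 0)) :
    (∀ᵐ x ∂μ, Tendsto (fun j => sliceNorm p ν (D j) x) atTop (𝓝 0)) ∧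
      Tendsto (fun j => mixedNorm p μ ν (D j)) atTop (𝓝 0) := by
  have hp1 := one_le_toReal_exponent hp hp_top
  have hb' : ∀ᵐ x ∂μ, ∀ j, ∀ᵐ y ∂ν, ‖D j (x, y)‖ ≤ C :=
    ae_all_iff.2 fun j => Measure.ae_ae_of_ae_prod (hb j)
  have h1 : ∀ᵐ x ∂μ, Tendsto (fun j => sliceNorm p ν (D j) x) atTop (𝓝 0) := by
    filter_upwards [hb', Measure.ae_ae_of_ae_prod ht] with x hx hx'
    simp_rw [sliceNorm_eq hp hp_top]
    have : Tendsto (fun j => ∫⁻ y, ‖D j (x, y)‖ₑ ^ p.toReal ∂ν) atTop (𝓝 (∫⁻ _, 0 ∂ν)) := by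
      refine tendsto_lintegral_of_dominated_convergence (fun _ => (C : ℝ≥0∞) ^ p.toReal)
        (fun j => ((hD j).comp measurable_prodMk_left).enorm.pow_const _) (fun j => ?_) ?_ ?_
      · filter_upwards [hx j] with y hy
        refine ENNReal.rpow_le_rpow ?_ (by linarith)
        rw [← ofReal_norm]
        exact ENNReal.ofReal_le_of_le_toReal (by simpa using hy)
      · simp [ENNReal.rpow_ne_top_of_nonneg (zero_le_one.trans hp1)]
      · filter_upwards [hx'] with y hy
        have h := (ENNReal.continuous_rpow_const (y := p.toReal)).tendsto 0
        rw [ENNReal.zero_rpow_of_pos (by linarith)] at h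
        refine h.comp ?_
        have := (continuous_enorm.tendsto (0 : 𝕜)).comp hy
        simpa [Function.comp_def] using this
    have h := ((ENNReal.continuous_rpow_const (y := 1 / p.toReal)).tendsto _).comp this
    simpa [(zero_lt_one.trans_le hp1), Function.comp_def] using h
  refine ⟨h1, ?_⟩
  have : Tendsto (fun j => mixedNorm p μ ν (D j)) atTop (𝓝 (∫⁻ _, 0 ∂μ)) := by
    refine tendsto_lintegral_of_dominated_convergence (fun _ => (C : ℝ≥0∞))
      (fun j => measurable_sliceNorm hp hp_top (hD j)) (fun j => ?_)
      (by rw [lintegral_const]; finiteness) h1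
    filter_upwards [hb'] with x hx
    exact sliceNorm_le_of_bound (hx j)
  simpa using this

/-- Bounded functions are dense for the mixed norm. -/
theorem exists_bounded_mixedNorm_sub_le (hp : 1 ≤ p) (hp_top : p ≠ ∞) {F : X × Y → 𝕜}
    (hF : Measurable F) (hF_top : mixedNorm p μ ν F < ∞) {ε : ℝ≥0∞} (hε : 0 < ε) :
    ∃ H : X × Y → 𝕜, Measurable H ∧ (∃ C : ℝ≥0, ∀ z, ‖H z‖ ≤ C) ∧
      mixedNorm p μ ν (F - H) ≤ ε := by
  have hp1 := one_le_toReal_exponent hp hp_top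
  -- `D n` is the part of `F` above height `n`. It is dominated by `F` and eventually zero at each
  -- point, so `F - D n` is the bounded approximant.
  set D : ℕ → X × Y → 𝕜 := fun n => {z | (n : ℝ) < ‖F z‖}.indicator F with hDdef
  have hDm : ∀ n, Measurable (D n) := fun n =>
    hF.indicator (measurableSet_lt measurable_const hF.norm)
  have hle : ∀ n z, ‖D n z‖ₑ ≤ ‖F z‖ₑ := fun n z => enorm_indicator_le_enorm_self _ _
  have hD0 : ∀ z, ∀ᶠ n in atTop, D n z = 0 := by
    intro z
    obtain ⟨k, hk⟩ := exists_nat_ge ‖F z‖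
    filter_upwards [eventually_ge_atTop k] with n hn
    refine Set.indicator_of_notMem ?_ _
    simp only [Set.mem_ofPred_eq, not_lt]
    exact hk.trans (by exact_mod_cast hn)
  have h1 : ∀ᵐ x ∂μ, Tendsto (fun n => sliceNorm p ν (D n) x) atTop (𝓝 0) := by
    filter_upwards [ae_lt_top (measurable_sliceNorm hp hp_top hF) hF_top.ne] with x hx
    simp_rw [sliceNorm_eq hp hp_top] at hx ⊢
    have : Tendsto (fun j => ∫⁻ y, ‖D j (x, y)‖ₑ ^ p.toReal ∂ν) atTop (𝓝 (∫⁻ _, 0 ∂ν)) := by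
      refine tendsto_lintegral_of_dominated_convergence (fun y => ‖F (x, y)‖ₑ ^ p.toReal)
        (fun j => ((hDm j).comp measurable_prodMk_left).enorm.pow_const _) (fun j => ?_) ?_ ?_
      · exact ae_of_all _ fun y => ENNReal.rpow_le_rpow (hle j _) (by linarith)
      · exact fun h => hx.ne (by rw [h, ENNReal.top_rpow_of_pos (by positivity)])
      · refine ae_of_all _ fun y => tendsto_const_nhds.congr' ?_
        filter_upwards [hD0 (x, y)] with n hn
        simp [hn, (zero_lt_one.trans_le hp1)]
    have h := ((ENNReal.continuous_rpow_const (y := 1 / p.toReal)).tendsto _).comp this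
    simpa [(zero_lt_one.trans_le hp1), Function.comp_def] using h
  have h2 : Tendsto (fun n => mixedNorm p μ ν (D n)) atTop (𝓝 (∫⁻ _, 0 ∂μ)) := by
    refine tendsto_lintegral_of_dominated_convergence (sliceNorm p ν F)
      (fun j => measurable_sliceNorm hp hp_top (hDm j)) (fun j => ae_of_all _ fun x => ?_)
      hF_top.ne h1
    exact eLpNorm_mono_enorm fun y => hle j _
  rw [lintegral_zero] at h2
  obtain ⟨n, hn⟩ := (h2.eventually (ge_mem_nhds hε)).exists
  refine ⟨F - D n, hF.sub (hDm n), ⟨n, fun z => ?_⟩, by simpa using hn⟩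
  by_cases hz : (n : ℝ) < ‖F z‖
  · simp [hDdef, hz]
  · have h0 : D n z = 0 := Set.indicator_of_notMem (s := {z | (n : ℝ) < ‖F z‖}) hz _
    rw [Pi.sub_apply, h0, sub_zero]
    simpa using not_lt.1 hz

end CondExp

/-! ### Lévy's upward theorem in the mixed norm -/

section Levy

variable {X Y 𝕜 : Type*} [RCLike 𝕜] {mX : MeasurableSpace X} [mY : MeasurableSpace Y]
  {p : ℝ≥0∞} {μ : Measure X} {ν : Measure Y}

theorem measurable_condExp_prodFiltration (ℱ : Filtration ℕ mX) (F : X × Y → 𝕜) (j : ℕ) :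
    Measurable ((μ.prod ν)[F | prodFiltration ℱ j]) :=
  (stronglyMeasurable_condExp.mono ((prodFiltration ℱ).le j)).measurable

theorem iSup_prodFiltration_le (ℱ : Filtration ℕ mX) :
    ⨆ i, (prodFiltration ℱ : Filtration ℕ (Prod.instMeasurableSpace : MeasurableSpace (X × Y))) i ≤
      (Prod.instMeasurableSpace : MeasurableSpace (X × Y)) :=
  iSup_le fun i => (prodFiltration ℱ).le i

theorem measurable_condExp_iSup_prodFiltration (ℱ : Filtration ℕ mX) (F : X × Y → 𝕜) :
    Measurable ((μ.prod ν)[F | ⨆ i, prodFiltration ℱ i]) :=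
  (stronglyMeasurable_condExp.mono (iSup_prodFiltration_le ℱ)).measurable

theorem memLp_slice_of_sliceNorm_lt_top {F : X × Y → 𝕜} (hF : Measurable F) {x : X}
    (h : sliceNorm p ν F x < ∞) : MemLp (fun y => F (x, y)) p ν :=
  ⟨(hF.comp measurable_prodMk_left).aestronglyMeasurable, h⟩

theorem ae_tendstoInLp [SFinite ν] {F : ℕ → X × Y → 𝕜} {G : X × Y → 𝕜} (hp : 1 ≤ p) (hp_top : p ≠ ∞)
    (hF : ∀ j, Measurable (F j)) (hG : Measurable G) (hF_top : ∀ j, mixedNorm p μ ν (F j) < ∞)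
    (hG_top : mixedNorm p μ ν G < ∞)
    (h : ∀ᵐ x ∂μ, Tendsto (fun j => sliceNorm p ν (F j - G) x) atTop (𝓝 0)) :
    ∀ᵐ x ∂μ, TendstoInLp p ν (fun j y => F j (x, y)) (fun y => G (x, y)) := by
  have h1 : ∀ᵐ x ∂μ, ∀ j, sliceNorm p ν (F j) x < ∞ :=
    ae_all_iff.2 fun j => ae_lt_top (measurable_sliceNorm hp hp_top (hF j)) (hF_top j).ne
  filter_upwards [h, h1, ae_lt_top (measurable_sliceNorm hp hp_top hG) hG_top.ne] with x hx h1 h2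
  exact ⟨fun j => memLp_slice_of_sliceNorm_lt_top (hF j) (h1 j),
    memLp_slice_of_sliceNorm_lt_top hG h2, hx⟩

variable [IsProbabilityMeasure ν]

theorem mixedNorm_condExp_iSup_le [SFinite μ] (ℱ : Filtration ℕ mX) (hp : 1 ≤ p) (hp_top : p ≠ ∞)
    {F : X × Y → 𝕜} (hF : Measurable F) (hint : Integrable F (μ.prod ν)) :
    mixedNorm p μ ν ((μ.prod ν)[F | ⨆ i, prodFiltration ℱ i]) ≤ mixedNorm p μ ν F := by
  rw [iSup_prodFiltration]
  exact mixedNorm_condExp_le (iSup_le fun i => ℱ.le i) hp hp_top hF hint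

/-- Splitting `F = (F - H) + H` leaves a convergent term for bounded `H` and two errors governed by
`F - H`. -/
theorem ae_sliceNorm_condExp_sub_le (ℱ : Filtration ℕ mX) (hp : 1 ≤ p)
    {F H : X × Y → 𝕜} (hF : Integrable F (μ.prod ν)) (hH : Integrable H (μ.prod ν)) :
    ∀ᵐ x ∂μ, ∀ j, sliceNorm p ν ((μ.prod ν)[F | prodFiltration ℱ j] -
        (μ.prod ν)[F | ⨆ i, prodFiltration ℱ i]) x ≤
      sliceNorm p ν ((μ.prod ν)[F - H | prodFiltration ℱ j]) x +
      sliceNorm p ν ((μ.prod ν)[H | prodFiltration ℱ j] -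
        (μ.prod ν)[H | ⨆ i, prodFiltration ℱ i]) x +
      sliceNorm p ν ((μ.prod ν)[F - H | ⨆ i, prodFiltration ℱ i]) x := by
  refine ae_all_iff.2 fun j => ?_
  have h : ((μ.prod ν)[F | prodFiltration ℱ j] - (μ.prod ν)[F | ⨆ i, prodFiltration ℱ i])
      =ᵐ[μ.prod ν] (μ.prod ν)[F - H | prodFiltration ℱ j] +
        ((μ.prod ν)[H | prodFiltration ℱ j] - (μ.prod ν)[H | ⨆ i, prodFiltration ℱ i]) -
        (μ.prod ν)[F - H | ⨆ i, prodFiltration ℱ i] := by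
    filter_upwards [condExp_sub hF hH (prodFiltration ℱ j),
      condExp_sub hF hH (⨆ i, prodFiltration ℱ i)] with z h1 h2
    simp only [Pi.sub_apply, Pi.add_apply] at h1 h2 ⊢
    rw [h1, h2]; ring
  filter_upwards [sliceNorm_congr_ae (p := p) h] with x hx
  rw [hx]
  have m1 := measurable_condExp_prodFiltration (μ := μ) (ν := ν) ℱ (F - H) j
  have m2 := (measurable_condExp_prodFiltration (μ := μ) (ν := ν) ℱ H j).sub
    (measurable_condExp_iSup_prodFiltration (μ := μ) (ν := ν) ℱ H)
  have m3 := measurable_condExp_iSup_prodFiltration (μ := μ) (ν := ν) ℱ (F - H)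
  refine (sliceNorm_sub_le hp (m1.add m2) m3 x).trans ?_
  gcongr
  exact sliceNorm_add_le hp m1 m2 x

variable [IsProbabilityMeasure μ]

/-- Lévy's theorem for bounded functions. -/
theorem tendsto_sliceNorm_condExp_of_bound (ℱ : Filtration ℕ mX) (hp : 1 ≤ p) (hp_top : p ≠ ∞)
    {H : X × Y → 𝕜} (hH : Measurable H) {C : ℝ≥0} (hC : ∀ z, ‖H z‖ ≤ C) :
    (∀ᵐ x ∂μ, Tendsto (fun j => sliceNorm p ν ((μ.prod ν)[H | prodFiltration ℱ j] -
        (μ.prod ν)[H | ⨆ i, prodFiltration ℱ i]) x) atTop (𝓝 0)) ∧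
      Tendsto (fun j => mixedNorm p μ ν ((μ.prod ν)[H | prodFiltration ℱ j] -
        (μ.prod ν)[H | ⨆ i, prodFiltration ℱ i])) atTop (𝓝 0) := by
  have hint : Integrable H (μ.prod ν) :=
    Integrable.of_bound hH.aestronglyMeasurable C (ae_of_all _ hC)
  refine tendsto_sliceNorm_zero_of_bound (C := C + C) hp hp_top (fun j => ?_) (fun j => ?_) ?_
  · exact (measurable_condExp_prodFiltration ℱ H j).sub (measurable_condExp_iSup_prodFiltration ℱ H)
  · filter_upwards [ae_bdd_norm_condExp_of_ae_bdd_norm (m := prodFiltration ℱ j)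
      (ae_of_all (μ.prod ν) hC), ae_bdd_norm_condExp_of_ae_bdd_norm
      (m := ⨆ i, prodFiltration ℱ i) (ae_of_all (μ.prod ν) hC)] with z h1 h2
    exact (norm_sub_le _ _).trans (by push_cast; exact add_le_add h1 h2)
  · filter_upwards [tendsto_ae_condExp_rclike (ℱ := prodFiltration ℱ) hint] with z hz
    simpa using hz.sub_const (((μ.prod ν)[H | ⨆ i, prodFiltration ℱ i]) z)

theorem tendsto_mixedNorm_condExp (ℱ : Filtration ℕ mX) (hp : 1 ≤ p) (hp_top : p ≠ ∞)
    {F : X × Y → 𝕜} (hF : Measurable F) (hF_top : mixedNorm p μ ν F < ∞) :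
    Tendsto (fun j => mixedNorm p μ ν ((μ.prod ν)[F | prodFiltration ℱ j] -
      (μ.prod ν)[F | ⨆ i, prodFiltration ℱ i])) atTop (𝓝 0) := by
  have hFi := integrable_of_mixedNorm_lt_top hp hF hF_top
  refine ENNReal.tendsto_nhds_zero.2 fun ε hε => ?_
  have hε3 : 0 < ε / 3 := ENNReal.div_pos hε.ne' (by simp)
  obtain ⟨H, hH, ⟨C, hC⟩, hFH⟩ := exists_bounded_mixedNorm_sub_le (μ := μ) (ν := ν) hp hp_top hF
    hF_top hε3
  have hHi : Integrable H (μ.prod ν) :=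
    Integrable.of_bound hH.aestronglyMeasurable C (ae_of_all _ hC)
  have ht := (tendsto_sliceNorm_condExp_of_bound (μ := μ) (ν := ν) ℱ hp hp_top hH hC).2
  filter_upwards [ENNReal.tendsto_nhds_zero.1 ht (ε / 3) hε3] with j hj
  have m1 := measurable_condExp_prodFiltration (μ := μ) (ν := ν) ℱ (F - H) j
  have m2 := (measurable_condExp_prodFiltration (μ := μ) (ν := ν) ℱ H j).sub
    (measurable_condExp_iSup_prodFiltration (μ := μ) (ν := ν) ℱ H)
  calc mixedNorm p μ ν ((μ.prod ν)[F | prodFiltration ℱ j] -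
        (μ.prod ν)[F | ⨆ i, prodFiltration ℱ i])
      ≤ ∫⁻ x, (sliceNorm p ν ((μ.prod ν)[F - H | prodFiltration ℱ j]) x +
          sliceNorm p ν ((μ.prod ν)[H | prodFiltration ℱ j] -
            (μ.prod ν)[H | ⨆ i, prodFiltration ℱ i]) x +
          sliceNorm p ν ((μ.prod ν)[F - H | ⨆ i, prodFiltration ℱ i]) x) ∂μ :=
        lintegral_mono_ae ((ae_sliceNorm_condExp_sub_le ℱ hp hFi hHi).mono fun x hx => hx j)
    _ = mixedNorm p μ ν ((μ.prod ν)[F - H | prodFiltration ℱ j]) +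
          mixedNorm p μ ν ((μ.prod ν)[H | prodFiltration ℱ j] -
            (μ.prod ν)[H | ⨆ i, prodFiltration ℱ i]) +
          mixedNorm p μ ν ((μ.prod ν)[F - H | ⨆ i, prodFiltration ℱ i]) := by
        refine (lintegral_add_left ((measurable_sliceNorm hp hp_top m1).add
          (measurable_sliceNorm hp hp_top m2)) _).trans ?_
        exact congrArg (· + _) (lintegral_add_left (measurable_sliceNorm hp hp_top m1) _)
    _ ≤ ε / 3 + ε / 3 + ε / 3 := by
        gcongr
        · exact (mixedNorm_condExp_le (ℱ.le j) hp hp_top (hF.sub hH) (hFi.sub hHi)).trans hFH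
        · exact (mixedNorm_condExp_iSup_le ℱ hp hp_top (hF.sub hH) (hFi.sub hHi)).trans hFH
    _ = ε := ENNReal.add_thirds ε

/-- The term in `H` tends to zero, so a limsup above `2t` needs an error of size `t` either in the
supremum over `j` or at the limit σ-algebra. The maximal inequality bounds the first event, Markov
the second. -/
theorem mul_measure_limsup_le (ℱ : Filtration ℕ mX) (hp : 1 ≤ p) (hp_top : p ≠ ∞)
    {F H : X × Y → 𝕜} (hF : Measurable F) (hFi : Integrable F (μ.prod ν)) (hH : Measurable H)
    {C : ℝ≥0} (hC : ∀ z, ‖H z‖ ≤ C) {ε : ℝ≥0∞} (hFH : mixedNorm p μ ν (F - H) ≤ ε) (t : ℝ≥0∞) :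
    t * μ {x | t + t < limsup (fun j => sliceNorm p ν ((μ.prod ν)[F | prodFiltration ℱ j] -
      (μ.prod ν)[F | ⨆ i, prodFiltration ℱ i]) x) atTop} ≤ ε + ε := by
  have hHi : Integrable H (μ.prod ν) :=
    Integrable.of_bound hH.aestronglyMeasurable C (ae_of_all _ hC)
  set D : ℕ → X → ℝ≥0∞ := fun j => sliceNorm p ν ((μ.prod ν)[F - H | prodFiltration ℱ j]) with hD
  set D' : X → ℝ≥0∞ := sliceNorm p ν ((μ.prod ν)[F - H | ⨆ i, prodFiltration ℱ i]) with hD'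
  have hDsub : IsSubmartingaleENNReal D ℱ μ :=
    isSubmartingaleENNReal_sliceNorm hp hp_top (martingale_condExp (F - H) _ _)
  have h1 : t * μ {x | t < ⨆ j, D j x} ≤ ε :=
    (hDsub.mul_measure_iSup_le t).trans (iSup_le fun j =>
      (mixedNorm_condExp_le (ℱ.le j) hp hp_top (hF.sub hH) (hFi.sub hHi)).trans hFH)
  have h2 : t * μ {x | t ≤ D' x} ≤ ε :=
    (mul_meas_ge_le_lintegral (measurable_sliceNorm hp hp_top
      (measurable_condExp_iSup_prodFiltration ℱ (F - H))) t).trans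
      ((mixedNorm_condExp_iSup_le ℱ hp hp_top (hF.sub hH) (hFi.sub hHi)).trans hFH)
  refine le_trans ?_ (add_le_add h1 h2)
  rw [← mul_add]
  refine mul_le_mul_right ((measure_mono_ae ?_).trans (measure_union_le _ _)) t
  filter_upwards [ae_sliceNorm_condExp_sub_le ℱ hp hFi hHi,
    (tendsto_sliceNorm_condExp_of_bound (μ := μ) (ν := ν) ℱ hp hp_top hH hC).1] with x hx hx'
  intro hlt
  by_contra hcon
  obtain ⟨hcon1, hcon2⟩ := not_or.1 hcon
  replace hcon1 : ⨆ j, D j x ≤ t := not_lt.1 hcon1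
  replace hcon2 : D' x < t := not_le.1 hcon2
  refine absurd hlt (not_lt.2 ?_)
  have hle : limsup (fun j => sliceNorm p ν ((μ.prod ν)[F | prodFiltration ℱ j] -
      (μ.prod ν)[F | ⨆ i, prodFiltration ℱ i]) x) atTop ≤
      limsup (fun j => t + sliceNorm p ν ((μ.prod ν)[H | prodFiltration ℱ j] -
        (μ.prod ν)[H | ⨆ i, prodFiltration ℱ i]) x + t) atTop := by
    refine limsup_le_limsup (Eventually.of_forall fun j => (hx j).trans ?_)
    exact add_le_add (add_le_add ((le_iSup (fun j => D j x) j).trans hcon1) le_rfl) hcon2.le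
  refine hle.trans (le_of_eq ?_)
  have := (hx'.const_add t).add_const t
  simpa using this.limsup_eq

/-- The exceptional set in `mul_measure_limsup_le` does not depend on `H`, so improving the
approximation makes it null at every level; levels `1 / (n + 1)` suffice. -/
theorem ae_tendsto_sliceNorm_condExp (ℱ : Filtration ℕ mX) (hp : 1 ≤ p) (hp_top : p ≠ ∞)
    {F : X × Y → 𝕜} (hF : Measurable F) (hF_top : mixedNorm p μ ν F < ∞) :
    ∀ᵐ x ∂μ, Tendsto (fun j => sliceNorm p ν ((μ.prod ν)[F | prodFiltration ℱ j] -
      (μ.prod ν)[F | ⨆ i, prodFiltration ℱ i]) x) atTop (𝓝 0) := by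
  have hFi := integrable_of_mixedNorm_lt_top hp hF hF_top
  have h0 : ∀ n : ℕ, ∀ᵐ x ∂μ, limsup (fun j => sliceNorm p ν
      ((μ.prod ν)[F | prodFiltration ℱ j] - (μ.prod ν)[F | ⨆ i, prodFiltration ℱ i]) x) atTop ≤
      ((n : ℝ≥0∞) + 1)⁻¹ + ((n : ℝ≥0∞) + 1)⁻¹ := by
    intro n
    simp_rw [ae_iff, not_le]
    have hle : ∀ ε : ℝ≥0∞, 0 < ε → ((n : ℝ≥0∞) + 1)⁻¹ * μ {x | ((n : ℝ≥0∞) + 1)⁻¹ +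
        ((n : ℝ≥0∞) + 1)⁻¹ < limsup (fun j => sliceNorm p ν ((μ.prod ν)[F | prodFiltration ℱ j] -
          (μ.prod ν)[F | ⨆ i, prodFiltration ℱ i]) x) atTop} ≤ ε := by
      intro ε hε
      obtain ⟨H, hH, ⟨C, hC⟩, hFH⟩ := exists_bounded_mixedNorm_sub_le (μ := μ) (ν := ν) hp hp_top
        hF hF_top (ENNReal.half_pos hε.ne')
      exact (mul_measure_limsup_le ℱ hp hp_top hF hFi hH hC hFH _).trans_eq (ENNReal.add_halves ε)
    exact (mul_eq_zero.1 (le_antisymm (le_of_forall_gt_imp_ge_of_dense hle) zero_le)).resolve_left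
      (by simp)
  filter_upwards [ae_all_iff.2 h0] with x hx
  refine tendsto_of_le_liminf_of_limsup_le zero_le ?_
  have ht : Tendsto (fun n : ℕ => ((n : ℝ≥0∞) + 1)⁻¹ + ((n : ℝ≥0∞) + 1)⁻¹) atTop (𝓝 0) := by
    have h := ENNReal.tendsto_inv_nat_nhds_zero.comp (tendsto_add_atTop_nat 1)
    simpa [Function.comp_def] using h.add h
  exact ge_of_tendsto' ht hx

/-- Convergence of the conditional expectations of a function of finite mixed norm. -/
theorem mixedNorm_condExp_convergence (ℱ : Filtration ℕ mX) (hp : 1 ≤ p) (hp_top : p ≠ ∞)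
    {F : X × Y → 𝕜} (hF : Measurable F) (hF_top : mixedNorm p μ ν F < ∞) :
    Tendsto (fun j => mixedNorm p μ ν ((μ.prod ν)[F | prodFiltration ℱ j] -
        (μ.prod ν)[F | ⨆ i, prodFiltration ℱ i])) atTop (𝓝 0) ∧
      (∀ᵐ x ∂μ, TendstoInLp p ν (fun j y => ((μ.prod ν)[F | prodFiltration ℱ j]) (x, y))
        (fun y => ((μ.prod ν)[F | ⨆ i, prodFiltration ℱ i]) (x, y))) ∧
      (AEStronglyMeasurable[⨆ i, prodFiltration ℱ i] F (μ.prod ν) →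
        Tendsto (fun j => mixedNorm p μ ν ((μ.prod ν)[F | prodFiltration ℱ j] - F))
          atTop (𝓝 0) ∧
        ∀ᵐ x ∂μ, TendstoInLp p ν (fun j y => ((μ.prod ν)[F | prodFiltration ℱ j]) (x, y))
          (fun y => F (x, y))) := by
  have hFi := integrable_of_mixedNorm_lt_top hp hF hF_top
  have hj : ∀ j, mixedNorm p μ ν ((μ.prod ν)[F | prodFiltration ℱ j]) < ∞ := fun j =>
    (mixedNorm_condExp_le (ℱ.le j) hp hp_top hF hFi).trans_lt hF_top
  have h1 := tendsto_mixedNorm_condExp ℱ hp hp_top hF hF_top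
  have h2 := ae_tendsto_sliceNorm_condExp ℱ hp hp_top hF hF_top
  refine ⟨h1, ?_, fun hFm => ?_⟩
  · exact ae_tendstoInLp hp hp_top (measurable_condExp_prodFiltration ℱ F)
      (measurable_condExp_iSup_prodFiltration ℱ F) hj
      ((mixedNorm_condExp_iSup_le ℱ hp hp_top hF hFi).trans_lt hF_top) h2
  · have he : (μ.prod ν)[F | ⨆ i, prodFiltration ℱ i] =ᵐ[μ.prod ν] F :=
      condExp_of_aestronglyMeasurable' (iSup_prodFiltration_le ℱ) hFm hFi
    have he' : ∀ j, (μ.prod ν)[F | prodFiltration ℱ j] -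
        (μ.prod ν)[F | ⨆ i, prodFiltration ℱ i] =ᵐ[μ.prod ν]
        (μ.prod ν)[F | prodFiltration ℱ j] - F := fun j => by
      filter_upwards [he] with z hz
      simp [hz]
    refine ⟨h1.congr fun j => mixedNorm_congr_ae (he' j), ?_⟩
    refine ae_tendstoInLp hp hp_top (measurable_condExp_prodFiltration ℱ F) hF hj hF_top ?_
    filter_upwards [h2, ae_all_iff.2 fun j => sliceNorm_congr_ae (p := p) (he' j)] with x h3 h4
    exact h3.congr h4

end Levy

/-! ### Uniform integrability and closure of martingales -/

/-- Conditioning on `ℱ n` contracts `L^1`, while the conditional expectation of `f m - g` no longer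
depends on `m` once `m ≥ n`; a constant sequence tending to zero is zero. -/
theorem ae_eq_condExp_of_tendsto_eLpNorm {Ω E : Type*} [NormedAddCommGroup E] [NormedSpace ℝ E]
    [CompleteSpace E] {m0 : MeasurableSpace Ω} {μ : Measure Ω} {ℱ : Filtration ℕ m0}
    {f : ℕ → Ω → E} {g : Ω → E} (hf : Martingale f ℱ μ) (hg : Integrable g μ)
    (hgtends : Tendsto (fun n => eLpNorm (f n - g) 1 μ) atTop (𝓝 0)) (n : ℕ) :
    f n =ᵐ[μ] μ[g | ℱ n] := by
  rw [← sub_ae_eq_zero, ← eLpNorm_eq_zero_iff (((hf.stronglyMeasurable n).mono (ℱ.le _)).sub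
    (stronglyMeasurable_condExp.mono (ℱ.le _))).aestronglyMeasurable one_ne_zero]
  have ht : Tendsto (fun m => eLpNorm (μ[f m - g | ℱ n]) 1 μ) atTop (𝓝 0) :=
    tendsto_of_tendsto_of_tendsto_of_le_of_le tendsto_const_nhds hgtends (fun m => zero_le)
      fun m => eLpNorm_condExp_le_eLpNorm _ le_rfl
  have hev : ∀ m ≥ n, eLpNorm (μ[f m - g | ℱ n]) 1 μ = eLpNorm (f n - μ[g | ℱ n]) 1 μ := by
    refine fun m hm => eLpNorm_congr_ae ((condExp_sub (hf.integrable m) hg _).trans ?_)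
    filter_upwards [hf.2 n m hm] with x hx
    simp only [hx, Pi.sub_apply]
  exact tendsto_nhds_unique (tendsto_atTop_of_eventually_const hev) ht

/-- A uniformly integrable real or complex martingale is closed by its limit. -/
theorem exists_limit_of_uniformIntegrable_martingale {Ω 𝕜 : Type*} [RCLike 𝕜]
    {m0 : MeasurableSpace Ω} {μ : Measure Ω} [IsFiniteMeasure μ] {ℱ : Filtration ℕ m0}
    {f : ℕ → Ω → 𝕜} (hf : Martingale f ℱ μ) (hu : UniformIntegrable f 1 μ) :
    ∃ g : Ω → 𝕜, StronglyMeasurable[⨆ i, ℱ i] g ∧ Integrable g μ ∧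
      (∀ j, f j =ᵐ[μ] μ[g | ℱ j]) ∧ Tendsto (fun j => eLpNorm (f j - g) 1 μ) atTop (𝓝 0) ∧
      ∀ᵐ x ∂μ, Tendsto (fun j => f j x) atTop (𝓝 (g x)) := by
  obtain ⟨R, hR⟩ := hu.2.2
  -- Choosing `limUnder` at every point gives a limit measurable for `⨆ i, ℱ i`, not merely for the
  -- ambient σ-algebra.
  have hc : ∀ᵐ x ∂μ, Tendsto (fun j => f j x) atTop (𝓝 (limUnder atTop fun j => f j x)) := by
    filter_upwards [ae_exists_tendsto_of_martingale hf hR] with x hx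
    exact tendsto_nhds_limUnder hx
  have hm : StronglyMeasurable[⨆ i, ℱ i] fun x => limUnder atTop fun j => f j x :=
    @StronglyMeasurable.limUnder _ _ _ (⨆ i, ℱ i) _ _ _ _ _ _ _ fun j => (hf.1 j).mono (le_iSup (fun i => ℱ i) j)
  have hg := hu.integrable_of_ae_tendsto hc
  have hL := tendsto_Lp_finite_of_tendsto_ae le_rfl ENNReal.one_ne_top hu.1
    (memLp_one_iff_integrable.2 hg) hu.2.1 hc
  exact ⟨_, hm, hg, ae_eq_condExp_of_tendsto_eLpNorm hf hg hL, hL, hc⟩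

/-- This is where `p > 1` enters: `C ^ (1 - r)` tends to zero as `C` grows only for `r > 1`. -/
theorem exists_level_inv_rpow_mul_le {r : ℝ} (hr : 1 < r) (K : ℝ≥0) {ε : ℝ≥0∞} (hε : 0 < ε) :
    ∃ C : ℝ≥0, 0 < C ∧ ((C : ℝ≥0∞) ^ (r - 1))⁻¹ * (K : ℝ≥0∞) ^ r ≤ ε := by
  have hK : (K : ℝ≥0∞) ^ r ≠ ∞ := ENNReal.rpow_ne_top_of_nonneg (by linarith) ENNReal.coe_ne_top
  have h1 : Tendsto (fun n : ℕ => (n : ℝ≥0∞) ^ (r - 1)) atTop (𝓝 ∞) := by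
    have h := (ENNReal.continuous_rpow_const (y := r - 1)).tendsto ∞
    rw [ENNReal.top_rpow_of_pos (by linarith)] at h
    exact h.comp ENNReal.tendsto_nat_nhds_top
  have h2 : Tendsto (fun n : ℕ => ((n : ℝ≥0∞) ^ (r - 1))⁻¹ * (K : ℝ≥0∞) ^ r) atTop (𝓝 0) := by
    have h := ENNReal.Tendsto.mul_const (b := (K : ℝ≥0∞) ^ r) (tendsto_inv_iff.2 h1) (Or.inr hK)
    simpa using h
  obtain ⟨n, hn, hn0⟩ := ((h2.eventually (ge_mem_nhds hε)).and (eventually_gt_atTop 0)).exists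
  exact ⟨n, by exact_mod_cast hn0, by simpa using hn⟩

section UI

variable {X Y 𝕜 : Type*} [RCLike 𝕜] {mX : MeasurableSpace X} [mY : MeasurableSpace Y]
  {p : ℝ≥0∞} {μ : Measure X} {ν : Measure Y}

/-- Fatou's lemma is used twice, on the slices and then on `X`. -/
theorem mixedNorm_le_of_ae_tendsto [SFinite ν] (hp : 1 ≤ p) (hp_top : p ≠ ∞)
    {F : ℕ → X × Y → 𝕜} {G : X × Y → 𝕜} (hF : ∀ j, Measurable (F j)) {C : ℝ≥0∞}
    (hC : ∀ j, mixedNorm p μ ν (F j) ≤ C)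
    (h : ∀ᵐ z ∂(μ.prod ν), Tendsto (fun j => F j z) atTop (𝓝 (G z))) :
    mixedNorm p μ ν G ≤ C := by
  have h1 : ∀ᵐ x ∂μ, sliceNorm p ν G x ≤ liminf (fun j => sliceNorm p ν (F j) x) atTop := by
    filter_upwards [Measure.ae_ae_of_ae_prod h] with x hx
    exact Lp.eLpNorm_lim_le_liminf_eLpNorm
      (fun j => ((hF j).comp measurable_prodMk_left).aestronglyMeasurable) _ hx
  refine (lintegral_mono_ae h1).trans
    ((lintegral_liminf_le fun j => measurable_sliceNorm hp hp_top (hF j)).trans ?_)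
  exact liminf_le_of_le (by isBoundedDefault) fun b hb => by
    obtain ⟨j, hj⟩ := hb.exists
    exact hj.trans (hC j)

/-- The part of the integral above a level `C` is controlled by a power of the `L^p` norm. -/
theorem lintegral_indicator_enorm_le (hp : 1 < p) (hp_top : p ≠ ∞) {f : Y → 𝕜} {C : ℝ≥0}
    (hC : 0 < C) : ∫⁻ y, ‖{y | C ≤ ‖f y‖₊}.indicator f y‖ₑ ∂ν ≤
      ((C : ℝ≥0∞) ^ (p.toReal - 1))⁻¹ * eLpNorm f p ν ^ p.toReal := by
  have hp1 := one_le_toReal_exponent hp.le hp_top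
  have hC' : (C : ℝ≥0∞) ^ (p.toReal - 1) ≠ 0 := by simp [hC.ne']
  have hCt : (C : ℝ≥0∞) ^ (p.toReal - 1) ≠ ∞ :=
    ENNReal.rpow_ne_top_of_nonneg (by linarith) ENNReal.coe_ne_top
  rw [eLpNorm_eq_lintegral_rpow_enorm_toReal (zero_lt_one.trans hp).ne' hp_top,
    ← ENNReal.rpow_mul, one_div, inv_mul_cancel₀ (by linarith), ENNReal.rpow_one,
    ← lintegral_const_mul' _ _ (by simpa using hC')]
  refine lintegral_mono fun y => ?_
  by_cases hy : y ∈ {y | C ≤ ‖f y‖₊}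
  · rw [Set.indicator_of_mem hy]
    have hy' : (C : ℝ≥0∞) ≤ ‖f y‖ₑ := ENNReal.coe_le_coe.2 hy
    calc ‖f y‖ₑ = ((C : ℝ≥0∞) ^ (p.toReal - 1))⁻¹ * ((C : ℝ≥0∞) ^ (p.toReal - 1) * ‖f y‖ₑ) := by
          rw [← mul_assoc, ENNReal.inv_mul_cancel hC' hCt, one_mul]
      _ ≤ ((C : ℝ≥0∞) ^ (p.toReal - 1))⁻¹ * (‖f y‖ₑ ^ (p.toReal - 1) * ‖f y‖ₑ ^ (1 : ℝ)) := by
          rw [ENNReal.rpow_one]; gcongr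
      _ = ((C : ℝ≥0∞) ^ (p.toReal - 1))⁻¹ * ‖f y‖ₑ ^ p.toReal := by
          rw [← ENNReal.rpow_add_of_nonneg _ _ (by linarith) zero_le_one]; simp
  · rw [Set.indicator_of_notMem hy]; simp

variable [IsProbabilityMeasure ν]

/-- Split `X` by the size of the slice norm. Above `K`, the `L^1` norm of a slice is at most its
`L^p` norm, whose integral is small by hypothesis; below `K`, the part of the slice above level `C`
has integral at most `C ^ (1 - p) * K ^ p`. -/
theorem uniformIntegrable_of_sliceNorm [IsFiniteMeasure μ] (hp : 1 < p) (hp_top : p ≠ ∞)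
    {F : ℕ → X × Y → 𝕜} (hF : ∀ j, Measurable (F j)) (hF_top : ∀ j, mixedNorm p μ ν (F j) < ∞)
    (hu : UniformIntegrable (fun j x => (sliceNorm p ν (F j) x).toReal) 1 μ) :
    UniformIntegrable F 1 (μ.prod ν) := by
  have hp1 : 1 < p.toReal := by simpa using (ENNReal.toReal_lt_toReal (by simp) hp_top).2 hp
  refine uniformIntegrable_of le_rfl ENNReal.one_ne_top
    (fun j => (hF j).aestronglyMeasurable) fun ε hε => ?_
  -- The bound per slice is chosen to integrate to at most `ε / 2`; the added `1` covers `μ = 0`.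
  have hc : 0 < ε / (2 * (μ.real Set.univ + 1)) := by positivity
  obtain ⟨K, hK⟩ := hu.spec one_ne_zero ENNReal.one_ne_top (half_pos hε)
  obtain ⟨C, hC0, hC⟩ := exists_level_inv_rpow_mul_le hp1 K
    (ε := ENNReal.ofReal (ε / (2 * (μ.real Set.univ + 1)))) (by simpa using hc)
  refine ⟨C, fun j => ?_⟩
  have hms : MeasurableSet {z | C ≤ ‖F j z‖₊} := measurableSet_le measurable_const (hF j).nnnorm
  have hmN := measurable_sliceNorm (ν := ν) hp.le hp_top (hF j)
  have hmK : MeasurableSet {x | K ≤ ‖(sliceNorm p ν (F j) x).toReal‖₊} :=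
    measurableSet_le measurable_const hmN.ennreal_toReal.nnnorm
  rw [eLpNorm_one_eq_lintegral_enorm, lintegral_prod _ ((hF j).indicator hms).enorm.aemeasurable]
  have hpt : ∀ᵐ x ∂μ, ∫⁻ y, ‖{z | C ≤ ‖F j z‖₊}.indicator (F j) (x, y)‖ₑ ∂ν ≤
      ‖{x | K ≤ ‖(sliceNorm p ν (F j) x).toReal‖₊}.indicator
        (fun x => (sliceNorm p ν (F j) x).toReal) x‖ₑ +
      ENNReal.ofReal (ε / (2 * (μ.real Set.univ + 1))) := by
    filter_upwards [ae_lt_top hmN (hF_top j).ne] with x hx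
    by_cases hxK : x ∈ {x | K ≤ ‖(sliceNorm p ν (F j) x).toReal‖₊}
    · refine le_add_right ?_
      rw [Set.indicator_of_mem hxK, Real.enorm_eq_ofReal ENNReal.toReal_nonneg,
        ENNReal.ofReal_toReal hx.ne]
      refine (lintegral_mono fun y => enorm_indicator_le_enorm_self _ _).trans ?_
      have := eLpNorm_le_eLpNorm_of_exponent_le (μ := ν) hp.le
        ((hF j).comp (measurable_prodMk_left (x := x))).aestronglyMeasurable
      rw [eLpNorm_one_eq_lintegral_enorm] at this
      exact this
    · refine le_add_left ?_
      refine (lintegral_indicator_enorm_le (f := fun y => F j (x, y)) hp hp_top hC0).trans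
        (le_trans ?_ hC)
      gcongr
      have h1 : ‖(sliceNorm p ν (F j) x).toReal‖₊ < K := not_le.1 hxK
      have h2 : (sliceNorm p ν (F j) x).toReal ≤ K := by
        have : ‖(sliceNorm p ν (F j) x).toReal‖ < K := by exact_mod_cast h1
        exact (le_abs_self _).trans this.le
      change sliceNorm p ν (F j) x ≤ K
      rw [← ENNReal.ofReal_toReal hx.ne]
      exact ENNReal.ofReal_le_of_le_toReal (by simpa using h2)
  refine (lintegral_mono_ae hpt).trans ?_
  rw [lintegral_add_right _ measurable_const, ← eLpNorm_one_eq_lintegral_enorm, lintegral_const]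
  refine (add_le_add_left (hK j) _).trans ?_
  rw [← ofReal_measureReal, ← ENNReal.ofReal_mul hc.le, ← ENNReal.ofReal_add (by positivity)
    (by positivity)]
  refine ENNReal.ofReal_le_ofReal ?_
  have : ε / (2 * (μ.real Set.univ + 1)) * μ.real Set.univ ≤ ε / 2 := by
    have h0 : 0 ≤ μ.real Set.univ := measureReal_nonneg
    rw [div_mul_eq_mul_div, div_le_div_iff₀ (by positivity) two_pos]
    nlinarith
  linarith

variable [IsProbabilityMeasure μ] {ℱ : Filtration ℕ mX}

/-- Convergence of martingales with uniformly integrable slice norms. -/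
theorem mixedNorm_martingale_convergence (hp : 1 < p) (hp_top : p ≠ ∞) {F : ℕ → X × Y → 𝕜}
    (hF : Martingale F (prodFiltration ℱ) (μ.prod ν)) {C : ℝ≥0}
    (hC : ∀ j, mixedNorm p μ ν (F j) ≤ C)
    (hu : UniformIntegrable (fun j x => (sliceNorm p ν (F j) x).toReal) 1 μ) :
    UniformIntegrable F 1 (μ.prod ν) ∧
      ∃ G : X × Y → 𝕜, StronglyMeasurable G ∧ mixedNorm p μ ν G < ∞ ∧
        (∀ j, F j =ᵐ[μ.prod ν] (μ.prod ν)[G | prodFiltration ℱ j]) ∧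
        Tendsto (fun j => eLpNorm (F j - G) 1 (μ.prod ν)) atTop (𝓝 0) ∧
        (∀ᵐ z ∂(μ.prod ν), Tendsto (fun j => F j z) atTop (𝓝 (G z))) ∧
        Tendsto (fun j => mixedNorm p μ ν (F j - G)) atTop (𝓝 0) ∧
        ∀ᵐ x ∂μ, TendstoInLp p ν (fun j y => F j (x, y)) (fun y => G (x, y)) := by
  have hFm : ∀ j, Measurable (F j) := fun j =>
    ((hF.1 j).mono ((prodFiltration ℱ).le j)).measurable
  have hF_top : ∀ j, mixedNorm p μ ν (F j) < ∞ := fun j => (hC j).trans_lt ENNReal.coe_lt_top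
  have hFu := uniformIntegrable_of_sliceNorm hp hp_top hFm hF_top hu
  obtain ⟨G, hGm, -, hGF, hGL, hGae⟩ := exists_limit_of_uniformIntegrable_martingale hF hFu
  have hG0 : StronglyMeasurable G := hGm.mono (iSup_prodFiltration_le ℱ)
  have hG_top : mixedNorm p μ ν G < ∞ :=
    (mixedNorm_le_of_ae_tendsto hp.le hp_top hFm hC hGae).trans_lt ENNReal.coe_lt_top
  obtain ⟨h1, h2⟩ := (mixedNorm_condExp_convergence ℱ hp.le hp_top hG0.measurable hG_top).2.2
    hGm.aestronglyMeasurable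
  have he : ∀ j, (μ.prod ν)[G | prodFiltration ℱ j] - G =ᵐ[μ.prod ν] F j - G := fun j =>
    (hGF j).symm.sub EventuallyEq.rfl
  refine ⟨hFu, G, hG0, hG_top, hGF, hGL, hGae, h1.congr fun j => mixedNorm_congr_ae (he j), ?_⟩
  refine ae_tendstoInLp hp.le hp_top hFm hG0.measurable hF_top hG_top ?_
  filter_upwards [h2, ae_all_iff.2 fun j => sliceNorm_congr_ae (p := p) (he j)] with x h3 h4
  exact h3.2.2.congr h4

end UI

/-! ### Stopping at the first exceedance of a level -/

section Stopping

variable {X : Type*} {mX : MeasurableSpace X}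

/-- The event that the process has not exceeded the level `t` up to time `j`. -/
def notExceeded (N : ℕ → X → ℝ≥0∞) (t : ℝ≥0∞) (j : ℕ) : Set X :=
  {x | ∀ i ≤ j, N i x ≤ t}

open Classical in
/-- The minimum of `j` and the first time at which the process exceeds the level `t`. -/
noncomputable def stoppedIndex (N : ℕ → X → ℝ≥0∞) (t : ℝ≥0∞) : ℕ → X → ℕ
  | 0, _ => 0
  | j + 1, x => if x ∈ notExceeded N t j then j + 1 else stoppedIndex N t j x

variable {N : ℕ → X → ℝ≥0∞} {t : ℝ≥0∞}

theorem measurableSet_notExceeded {ℱ : Filtration ℕ mX} (hN : ∀ j, Measurable[ℱ j] (N j))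
    (j : ℕ) : MeasurableSet[ℱ j] (notExceeded N t j) := by
  have : notExceeded N t j = ⋂ i, ⋂ (_ : i ≤ j), N i ⁻¹' Set.Iic t := by
    ext x; simp [notExceeded]
  rw [this]
  exact MeasurableSet.iInter fun i => MeasurableSet.iInter fun hi =>
    ℱ.mono hi _ (hN i measurableSet_Iic)

theorem notExceeded_anti {i j : ℕ} (hij : i ≤ j) : notExceeded N t j ⊆ notExceeded N t i :=
  fun _ hx k hk => hx k (hk.trans hij)

theorem stoppedIndex_of_mem {j : ℕ} {x : X} (hx : x ∈ notExceeded N t j) :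
    stoppedIndex N t j x = j := by
  cases j with
  | zero => rfl
  | succ j => exact if_pos (notExceeded_anti j.le_succ hx)

theorem le_of_lt_stoppedIndex (j : ℕ) (x : X) :
    ∀ i < stoppedIndex N t j x, N i x ≤ t := by
  induction j with
  | zero => intro i hi; exact absurd hi (Nat.not_lt_zero i)
  | succ j ih =>
    by_cases hx : x ∈ notExceeded N t j
    · rw [stoppedIndex, if_pos hx]
      exact fun i hi => hx i (Nat.lt_succ_iff.1 hi)
    · rw [stoppedIndex, if_neg hx]
      exact ih

/-- The stopped process is bounded by the level and the value at the first exceedance. -/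
theorem apply_stoppedIndex_le (j : ℕ) (x : X) :
    N (stoppedIndex N t j x) x ≤
      t + ∑' i, (IsSubmartingaleENNReal.firstExceed N t i).indicator (N i) x := by
  rcases le_or_gt (N (stoppedIndex N t j x) x) t with h | h
  · exact le_add_right h
  · refine le_add_left ?_
    have hx : x ∈ IsSubmartingaleENNReal.firstExceed N t (stoppedIndex N t j x) :=
      ⟨h, le_of_lt_stoppedIndex j x⟩
    refine le_trans (le_of_eq ?_) (ENNReal.le_tsum (stoppedIndex N t j x))
    rw [Set.indicator_of_mem hx]

end Stopping

/-! ### Stopped martingales and convergence for bounded mixed norms -/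

section Bounded

variable {X Y 𝕜 : Type*} [RCLike 𝕜] {mX : MeasurableSpace X}

/-- The process `F` stopped when `N` exceeds the level `t`. -/
noncomputable def stoppedAt (N : ℕ → X → ℝ≥0∞) (t : ℝ≥0∞) (F : ℕ → X × Y → 𝕜) (j : ℕ) (z : X × Y) : 𝕜 :=
  F (stoppedIndex N t j z.1) z

/-- Whether the step from `j` to `j + 1` is taken depends only on times up to `j`, so the increment
is cut off by a set of the past. This is what preserves the martingale property. -/
theorem stoppedAt_succ (N : ℕ → X → ℝ≥0∞) (t : ℝ≥0∞) (F : ℕ → X × Y → 𝕜) (j : ℕ) :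
    stoppedAt N t F (j + 1) = stoppedAt N t F j +
      (Prod.fst ⁻¹' notExceeded N t j).indicator (F (j + 1) - F j) := by
  ext z
  by_cases hz : z.1 ∈ notExceeded N t j
  · have hz' : z ∈ Prod.fst ⁻¹' notExceeded N t j := hz
    rw [Pi.add_apply, Set.indicator_of_mem hz', stoppedAt, stoppedAt, stoppedIndex_of_mem hz,
      stoppedIndex, if_pos hz]
    simp
  · have hz' : z ∉ Prod.fst ⁻¹' notExceeded N t j := hz
    rw [Pi.add_apply, Set.indicator_of_notMem hz', stoppedAt, stoppedAt, stoppedIndex, if_neg hz,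
      add_zero]

variable [mY : MeasurableSpace Y] {p : ℝ≥0∞} {μ : Measure X} {ν : Measure Y}
  {ℱ : Filtration ℕ mX}

theorem sliceNorm_stoppedAt (N : ℕ → X → ℝ≥0∞) (t : ℝ≥0∞) (F : ℕ → X × Y → 𝕜) (j : ℕ) (x : X) :
    sliceNorm p ν (stoppedAt N t F j) x = sliceNorm p ν (F (stoppedIndex N t j x)) x := rfl

theorem measurableSet_preimage_notExceeded {N : ℕ → X → ℝ≥0∞} (hN : ∀ j, Measurable[ℱ j] (N j))
    (t : ℝ≥0∞) (j : ℕ) :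
    MeasurableSet[(prodFiltration ℱ : Filtration ℕ
      (Prod.instMeasurableSpace : MeasurableSpace (X × Y))) j]
      (Prod.fst ⁻¹' notExceeded N t j) :=
  (@measurable_fst _ _ (ℱ j) mY) (measurableSet_notExceeded hN j)

theorem martingale_stoppedAt [IsFiniteMeasure μ] [IsFiniteMeasure ν] {N : ℕ → X → ℝ≥0∞}
    (hN : ∀ j, Measurable[ℱ j] (N j)) (t : ℝ≥0∞) {F : ℕ → X × Y → 𝕜}
    (hF : Martingale F (prodFiltration ℱ) (μ.prod ν)) :
    Martingale (stoppedAt N t F) (prodFiltration ℱ) (μ.prod ν) := by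
  have hB := fun j => measurableSet_preimage_notExceeded (Y := Y) hN t j
  have hB0 := fun j => (prodFiltration ℱ).le j _ (hB j)
  have hint : ∀ j, Integrable (stoppedAt N t F j) (μ.prod ν) := by
    intro j
    induction j with
    | zero => exact hF.integrable 0
    | succ j ih =>
      rw [stoppedAt_succ]
      exact ih.add (((hF.integrable (j + 1)).sub (hF.integrable j)).indicator (hB0 j))
  refine martingale_of_setIntegral_eq_succ (fun j => ?_) hint fun j S hS => ?_
  · induction j with
    | zero => exact hF.1 0
    | succ j ih =>
      rw [stoppedAt_succ]
      exact (ih.mono ((prodFiltration ℱ).mono j.le_succ)).add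
        (((hF.1 (j + 1)).sub ((hF.1 j).mono ((prodFiltration ℱ).mono j.le_succ))).indicator
          ((prodFiltration ℱ).mono j.le_succ _ (hB j)))
  · have hd := (hF.integrable (j + 1)).sub (hF.integrable j)
    have h0 : ∫ z in S, (Prod.fst ⁻¹' notExceeded N t j).indicator (F (j + 1) - F j) z
        ∂(μ.prod ν) = 0 := by
      rw [setIntegral_indicator (hB0 j)]
      simp only [Pi.sub_apply]
      rw [integral_sub (hF.integrable (j + 1)).integrableOn (hF.integrable j).integrableOn,
        hF.setIntegral_eq j.le_succ (hS.inter (hB j)), sub_self]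
    rw [stoppedAt_succ]
    simp only [Pi.add_apply]
    rw [integral_add (hint j).integrableOn (hd.indicator (hB0 j)).integrableOn, h0, add_zero]

theorem uniformIntegrable_toReal_of_le {Ω : Type*} {m0 : MeasurableSpace Ω} {P : Measure Ω}
    {N : ℕ → Ω → ℝ≥0∞} {g : Ω → ℝ≥0∞} (hN : ∀ j, Measurable (N j)) (hg : Measurable g)
    (hg_top : ∫⁻ x, g x ∂P ≠ ∞) (h : ∀ j x, N j x ≤ g x) :
    UniformIntegrable (fun j x => (N j x).toReal) 1 P := by
  have hgi : MemLp (fun x => (g x).toReal) 1 P := memLp_one_iff_integrable.2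
    (integrable_toReal_of_lintegral_ne_top hg.aemeasurable hg_top)
  obtain ⟨-, hu, C, hC⟩ := uniformIntegrable_const (ι := ℕ) le_rfl ENNReal.one_ne_top hgi
  have hle : ∀ j, ∀ᵐ x ∂P, ‖(N j x).toReal‖ ≤ ‖(g x).toReal‖ := by
    intro j
    filter_upwards [ae_lt_top hg hg_top] with x hx
    rw [Real.norm_of_nonneg ENNReal.toReal_nonneg, Real.norm_of_nonneg ENNReal.toReal_nonneg]
    exact ENNReal.toReal_mono hx.ne (h j x)
  refine ⟨fun j => (hN j).ennreal_toReal.aestronglyMeasurable, fun ε hε => ?_, C, fun j => ?_⟩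
  · obtain ⟨δ, hδ, hd⟩ := hu hε
    refine ⟨δ, hδ, fun j s hs hμs => (eLpNorm_mono_ae ?_).trans (hd j s hs hμs)⟩
    filter_upwards [hle j] with x hx
    by_cases hxs : x ∈ s
    · simpa [hxs] using hx
    · simp [hxs]
  · exact (eLpNorm_mono_ae (hle j)).trans (hC j)

variable [IsProbabilityMeasure μ] [IsProbabilityMeasure ν]

/-- Almost everywhere convergence of martingales of bounded mixed norm. -/
theorem ae_exists_tendstoInLp_of_bounded (hp : 1 < p) (hp_top : p ≠ ∞) {F : ℕ → X × Y → 𝕜}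
    (hF : Martingale F (prodFiltration ℱ) (μ.prod ν)) {C : ℝ≥0}
    (hC : ∀ j, mixedNorm p μ ν (F j) ≤ C) :
    ∀ᵐ x ∂μ, ∃ g : Y → 𝕜, TendstoInLp p ν (fun j y => F j (x, y)) g := by
  set N : ℕ → X → ℝ≥0∞ := fun j => sliceNorm p ν (F j) with hNdef
  have hN : IsSubmartingaleENNReal N ℱ μ := isSubmartingaleENNReal_sliceNorm hp.le hp_top hF
  have hsup : ⨆ j, ∫⁻ x, N j x ∂μ ≤ C := iSup_le hC
  have key : ∀ n : ℕ, ∀ᵐ x ∂μ, ⨆ j, N j x ≤ n →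
      ∃ g : Y → 𝕜, TendstoInLp p ν (fun j y => F j (x, y)) g := by
    intro n
    -- This one function dominates every stopped slice norm: before the exceedance the norm is at
    -- most `n`, afterwards it is frozen at the value of first exceedance. Its integral is at most
    -- `n + C`.
    set g : X → ℝ≥0∞ := fun x => n +
      ∑' i, (IsSubmartingaleENNReal.firstExceed N n i).indicator (N i) x with hg
    have hm : ∀ i, Measurable ((IsSubmartingaleENNReal.firstExceed N n i).indicator (N i)) :=
      fun i => (hN.measurable' i).indicator (ℱ.le i _ (hN.measurableSet_firstExceed n i))
    have hgm : Measurable g := measurable_const.add (Measurable.tsum hm)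
    have hg_le : ∫⁻ x, g x ∂μ ≤ n + C := by
      rw [hg, lintegral_add_left measurable_const, lintegral_tsum fun i => (hm i).aemeasurable]
      refine add_le_add (by simp) (le_trans (le_of_eq ?_)
        ((hN.tsum_setLIntegral_firstExceed_le n).trans hsup))
      exact tsum_congr fun i =>
        lintegral_indicator (ℱ.le i _ (hN.measurableSet_firstExceed n i)) _
    have hg_top : ∫⁻ x, g x ∂μ ≠ ∞ := ne_top_of_le_ne_top (by finiteness) hg_le
    have hS := martingale_stoppedAt hN.measurable n hF
    have hSg : ∀ j x, sliceNorm p ν (stoppedAt N n F j) x ≤ g x := fun j x => by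
      rw [sliceNorm_stoppedAt]
      exact apply_stoppedIndex_le (N := N) j x
    have hSm : ∀ j, Measurable (sliceNorm p ν (stoppedAt N n F j)) := fun j =>
      measurable_sliceNorm hp.le hp_top ((hS.1 j).mono ((prodFiltration ℱ).le j)).measurable
    obtain ⟨-, G, -, -, -, -, -, -, hG⟩ := mixedNorm_martingale_convergence hp hp_top hS
      (C := n + C) (fun j => (lintegral_mono (hSg j)).trans (by push_cast; exact hg_le))
      (uniformIntegrable_toReal_of_le hSm hgm hg_top hSg)
    filter_upwards [hG] with x hx hxn
    refine ⟨fun y => G (x, y), ?_⟩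
    have he : (fun j y => stoppedAt N n F j (x, y)) = fun j y => F j (x, y) := by
      ext j y
      rw [stoppedAt, stoppedIndex_of_mem]
      exact fun i _ => (le_iSup (fun i => N i x) i).trans hxn
    rw [← he]
    exact hx
  filter_upwards [ae_all_iff.2 key, hN.ae_iSup_lt_top (ne_top_of_le_ne_top ENNReal.coe_ne_top hsup)]
    with x hx hxt
  obtain ⟨n, hn⟩ := ENNReal.exists_nat_gt hxt.ne
  exact hx n hn.le

end Bounded

/-! ### Minkowski inequalities and `ℓ^p` norms -/

section Sequences

/-- The conditional Minkowski inequality for countable families. -/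
theorem setLIntegral_tsum_rpow_le {X ι : Type*} [Countable ι] {m mX : MeasurableSpace X}
    (hm : m ≤ mX) {μ : Measure X} [SFinite μ] {r : ℝ} (hr : 1 ≤ r) {G F : ι → X → ℝ≥0∞}
    (hG : ∀ l, Measurable[m] (G l)) (hF : ∀ l, Measurable (F l))
    (hGF : ∀ l A, MeasurableSet[m] A → ∫⁻ x in A, G l x ∂μ ≤ ∫⁻ x in A, F l x ∂μ)
    {A : Set X} (hA : MeasurableSet[m] A) :
    ∫⁻ x in A, (∑' l, G l x ^ r) ^ (1 / r) ∂μ ≤ ∫⁻ x in A, (∑' l, F l x ^ r) ^ (1 / r) ∂μ := by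
  -- The index set with counting measure takes the role of `Y`; this is why the product version
  -- allows σ-finite `ν`.
  let mι : MeasurableSpace ι := ⊤
  have hsc : MeasurableSingletonClass ι := ⟨fun _ => trivial⟩
  have hmm : m.prod mι ≤ mX.prod mι := MeasurableSpace.prod_mono_left mι hm
  have hG' : Measurable[m.prod mι] fun z : X × ι => G z.2 z.1 :=
    @measurable_from_prod_countable_left _ _ _ m mι _ _ _ _ hG
  have hF' : Measurable fun z : X × ι => F z.2 z.1 := measurable_from_prod_countable_left hF
  have h := setLIntegral_rpow_le_of_forall_setLIntegral_le (μ := μ)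
    (ν := (Measure.count : Measure ι)) hm hr hG' hF' (fun S hS => ?_) hA
  · simpa only [lintegral_count] using h
  · have hS0 := hmm _ hS
    have hSl : ∀ l, MeasurableSet[m] ((fun x => (x, l)) ⁻¹' S) := fun l =>
      (@measurable_prodMk_right _ _ m mι l) hS
    rw [← lintegral_indicator hS0, ← lintegral_indicator hS0,
      lintegral_prod_symm _ ((hG'.mono hmm le_rfl).indicator hS0).aemeasurable,
      lintegral_prod_symm _ (hF'.indicator hS0).aemeasurable]
    refine lintegral_mono fun l => ?_
    have := hGF l _ (hSl l)
    rwa [← lintegral_indicator (hm _ (hSl l)), ← lintegral_indicator (hm _ (hSl l))] at this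

/-- Minkowski's integral inequality for two functions. -/
theorem lintegral_rpow_add_lintegral_rpow_le {X : Type*} {mX : MeasurableSpace X} {μ : Measure X}
    [IsProbabilityMeasure μ] {r : ℝ} (hr : 1 ≤ r) {h t : X → ℝ≥0∞} (hh : Measurable h)
    (ht : Measurable t) :
    (∫⁻ x, h x ∂μ) ^ r + (∫⁻ x, t x ∂μ) ^ r ≤
      (∫⁻ x, (h x ^ r + t x ^ r) ^ (1 / r) ∂μ) ^ r := by
  -- Over the trivial σ-algebra, conditional expectations are the constants given by the integrals,
  -- so the conditional inequality becomes the integral one.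
  have key := setLIntegral_tsum_rpow_le (ι := Bool) (μ := μ) (m := ⊥) bot_le hr
    (G := fun b _ => bif b then ∫⁻ x, h x ∂μ else ∫⁻ x, t x ∂μ)
    (F := fun b x => bif b then h x else t x) (fun b => @measurable_const _ _ _ ⊥ _)
    (fun b => by cases b <;> assumption) (fun b A hA => ?_) (A := Set.univ) MeasurableSet.univ
  · have hr0 : 0 < r := by linarith
    simp only [tsum_fintype, Fintype.sum_bool, cond_true, cond_false, Measure.restrict_univ,
      lintegral_const, measure_univ, mul_one] at key
    have := ENNReal.rpow_le_rpow key hr0.le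
    rwa [← ENNReal.rpow_mul, one_div_mul_cancel hr0.ne', ENNReal.rpow_one] at this
  · rcases MeasurableSpace.measurableSet_bot_iff.1 hA with rfl | rfl
    · simp
    · cases b <;> simp

variable {X 𝕜 : Type*} [RCLike 𝕜] {p : ℝ≥0∞}

theorem measurable_seqNorm {mX : MeasurableSpace X} {f : ℕ → X → 𝕜} (hf : ∀ l, Measurable (f l)) :
    Measurable fun x => seqNorm p (fun l => f l x) :=
  (Measurable.tsum fun l => (hf l).enorm.pow_const _).pow_const _

theorem seqNorm_eq_eLpNorm_count (hp : 1 ≤ p) (hp_top : p ≠ ∞) (a : ℕ → 𝕜) :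
    seqNorm p a = eLpNorm a p Measure.count := by
  rw [eLpNorm_eq_lintegral_rpow_enorm_toReal (zero_lt_one.trans_le hp).ne' hp_top,
    lintegral_count, seqNorm]

theorem seqNorm_sub_le (hp : 1 ≤ p) (hp_top : p ≠ ∞) (a b : ℕ → 𝕜) :
    seqNorm p (fun l => a l - b l) ≤ seqNorm p a + seqNorm p b := by
  simp_rw [seqNorm_eq_eLpNorm_count hp hp_top]
  exact eLpNorm_sub_le (measurable_of_countable a).aestronglyMeasurable
    (measurable_of_countable b).aestronglyMeasurable hp

theorem enorm_le_seqNorm (hp : 1 ≤ p) (hp_top : p ≠ ∞) (a : ℕ → 𝕜) (l : ℕ) :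
    ‖a l‖ₑ ≤ seqNorm p a := by
  rw [seqNorm_eq_eLpNorm_count hp hp_top]
  exact enorm_le_eLpNorm_count a l (zero_lt_one.trans_le hp).ne'

theorem seqNorm_rpow (hp : 1 ≤ p) (hp_top : p ≠ ∞) (a : ℕ → 𝕜) :
    seqNorm p a ^ p.toReal = ∑' l, ‖a l‖ₑ ^ p.toReal := by
  have := one_le_toReal_exponent hp hp_top
  rw [seqNorm, ← ENNReal.rpow_mul, one_div_mul_cancel (by linarith), ENNReal.rpow_one]

theorem sum_range_add_seqNorm_tail (hp : 1 ≤ p) (hp_top : p ≠ ∞) (a : ℕ → 𝕜) (n : ℕ) :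
    ∑ l ∈ Finset.range n, ‖a l‖ₑ ^ p.toReal + seqNorm p (fun l => a (n + l)) ^ p.toReal =
      ∑' l, ‖a l‖ₑ ^ p.toReal := by
  rw [seqNorm_rpow hp hp_top]
  simp_rw [add_comm n]
  exact ENNReal.summable.sum_add_tsum_nat_add' (f := fun l => ‖a l‖ₑ ^ p.toReal)

theorem seqNorm_head_rpow (hp : 1 ≤ p) (hp_top : p ≠ ∞) (a : ℕ → 𝕜) (n : ℕ) :
    seqNorm p (fun l => if l < n then a l else 0) ^ p.toReal =
      ∑ l ∈ Finset.range n, ‖a l‖ₑ ^ p.toReal := by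
  have := one_le_toReal_exponent hp hp_top
  rw [seqNorm_rpow hp hp_top, tsum_eq_sum (s := Finset.range n)]
  · exact Finset.sum_congr rfl fun l hl => by rw [if_pos (Finset.mem_range.1 hl)]
  · intro l hl
    rw [if_neg (by simpa using hl)]
    simp [zero_lt_one.trans_le this]

theorem seqNorm_eq_head_tail (hp : 1 ≤ p) (hp_top : p ≠ ∞) (a : ℕ → 𝕜) (n : ℕ) :
    (seqNorm p (fun l => if l < n then a l else 0) ^ p.toReal +
      seqNorm p (fun l => a (n + l)) ^ p.toReal) ^ (1 / p.toReal) = seqNorm p a := by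
  rw [seqNorm_head_rpow hp hp_top, sum_range_add_seqNorm_tail hp hp_top, seqNorm]

theorem memℓp_of_seqNorm_lt_top (hp : 1 ≤ p) (hp_top : p ≠ ∞) {a : ℕ → 𝕜}
    (h : seqNorm p a < ∞) : Memℓp a p := by
  have hr := one_le_toReal_exponent hp hp_top
  refine memℓp_gen ?_
  have : ∑' l, ‖a l‖ₑ ^ p.toReal ≠ ∞ := by
    rw [← seqNorm_rpow hp hp_top]
    exact ENNReal.rpow_ne_top_of_nonneg (by linarith) h.ne
  refine (ENNReal.summable_toReal this).congr fun l => ?_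
  rw [← ENNReal.toReal_rpow, toReal_enorm]

/-- Coordinatewise convergence with uniformly small tails is convergence in `ℓ^p`. -/
theorem tendstoInSeqLp_of_tails (hp : 1 ≤ p) (hp_top : p ≠ ∞) {u : ℕ → ℕ → 𝕜} {g : ℕ → 𝕜}
    (hu : ∀ j, seqNorm p (u j) < ∞) (hg : ∀ l, Tendsto (fun j => u j l) atTop (𝓝 (g l)))
    (ht : ∀ ε : ℝ≥0∞, 0 < ε → ∃ n, ∀ j, seqNorm p (fun l => u j (n + l)) ≤ ε) :
    TendstoInSeqLp p u g := by
  have hr := one_le_toReal_exponent hp hp_top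
  have hlim : Tendsto (fun j => seqNorm p (fun l => u j l - g l)) atTop (𝓝 0) := by
    refine ENNReal.tendsto_nhds_zero.2 fun ε hε => ?_
    have hε3 : 0 < ε / 3 := ENNReal.div_pos hε.ne' (by simp)
    obtain ⟨n, hn⟩ := ht (ε / 3) hε3
    -- Fatou for counting measure passes the uniform tail bound to the limit.
    have hgn : seqNorm p (fun l => g (n + l)) ≤ ε / 3 := by
      simp_rw [seqNorm_eq_eLpNorm_count hp hp_top] at hn ⊢
      refine (Lp.eLpNorm_lim_le_liminf_eLpNorm (f := fun j l => u j (n + l))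
        (fun j => (measurable_of_countable _).aestronglyMeasurable) _
        (ae_of_all _ fun l => hg (n + l))).trans ?_
      exact liminf_le_of_le (by isBoundedDefault) fun b hb => by
        obtain ⟨j, hj⟩ := hb.exists
        exact hj.trans (hn j)
    have hhead : Tendsto (fun j => (∑ l ∈ Finset.range n, ‖u j l - g l‖ₑ ^ p.toReal) ^
        (1 / p.toReal)) atTop (𝓝 0) := by
      have h1 : Tendsto (fun j => ∑ l ∈ Finset.range n, ‖u j l - g l‖ₑ ^ p.toReal) atTop
          (𝓝 (∑ l ∈ Finset.range n, 0)) := by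
        refine tendsto_finsetSum _ fun l _ => ?_
        have h2 : Tendsto (fun j => ‖u j l - g l‖ₑ) atTop (𝓝 0) := by
          have := (continuous_enorm.tendsto (0 : 𝕜)).comp
            (by simpa using (hg l).sub_const (g l) :
              Tendsto (fun j => u j l - g l) atTop (𝓝 (0 : 𝕜)))
          simpa [Function.comp_def] using this
        have h3 := ((ENNReal.continuous_rpow_const (y := p.toReal)).tendsto 0).comp h2
        simpa [Function.comp_def, zero_lt_one.trans_le hr] using h3
      have h3 := ((ENNReal.continuous_rpow_const (y := 1 / p.toReal)).tendsto _).comp h1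
      simpa [Function.comp_def, zero_lt_one.trans_le hr] using h3
    filter_upwards [ENNReal.tendsto_nhds_zero.1 hhead (ε / 3) hε3] with j hj
    have htail : seqNorm p (fun l => u j (n + l) - g (n + l)) ≤ ε / 3 + ε / 3 :=
      (seqNorm_sub_le hp hp_top (fun l => u j (n + l)) (fun l => g (n + l))).trans
        (add_le_add (hn j) hgn)
    calc seqNorm p (fun l => u j l - g l)
        = (∑ l ∈ Finset.range n, ‖u j l - g l‖ₑ ^ p.toReal +
            seqNorm p (fun l => u j (n + l) - g (n + l)) ^ p.toReal) ^ (1 / p.toReal) := by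
          rw [sum_range_add_seqNorm_tail hp hp_top (fun l => u j l - g l), seqNorm]
      _ ≤ (∑ l ∈ Finset.range n, ‖u j l - g l‖ₑ ^ p.toReal) ^ (1 / p.toReal) +
            (seqNorm p (fun l => u j (n + l) - g (n + l)) ^ p.toReal) ^ (1 / p.toReal) :=
          ENNReal.rpow_add_le_add_rpow _ _ (by positivity)
            (by rw [div_le_one (by linarith)]; exact hr)
      _ ≤ ε / 3 + (ε / 3 + ε / 3) := by
          refine add_le_add hj ?_
          rwa [← ENNReal.rpow_mul, mul_one_div_cancel (by linarith), ENNReal.rpow_one]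
      _ = ε := by rw [← add_assoc, ENNReal.add_thirds]
  refine ⟨fun j => memℓp_of_seqNorm_lt_top hp hp_top (hu j), ?_, hlim⟩
  obtain ⟨j, hj⟩ := (ENNReal.tendsto_nhds_zero.1 hlim 1 one_pos).exists
  refine memℓp_of_seqNorm_lt_top hp hp_top ?_
  have h := seqNorm_sub_le hp hp_top (u j) (fun l => u j l - g l)
  simp only [sub_sub_cancel] at h
  exact h.trans_lt (ENNReal.add_lt_top.2 ⟨hu j, hj.trans_lt ENNReal.one_lt_top⟩)

end Sequences

/-! ### Martingales with values in `ℓ^p` -/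

section SeqMartingale

variable {X 𝕜 : Type*} [RCLike 𝕜] {p : ℝ≥0∞} {mX : MeasurableSpace X} {μ : Measure X}
  {ℱ : Filtration ℕ mX} {f : ℕ → ℕ → X → 𝕜}

theorem isSubmartingaleENNReal_seqNorm [IsFiniteMeasure μ] (hp : 1 ≤ p) (hp_top : p ≠ ∞)
    (hf : ∀ l, Martingale (fun j => f j l) ℱ μ) :
    IsSubmartingaleENNReal (fun j x => seqNorm p (fun l => f j l x)) ℱ μ := by
  have hm : ∀ j l, Measurable[ℱ j] fun x => ‖f j l x‖ₑ := fun j l =>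
    measurable_enorm.comp ((hf l).1 j).measurable
  refine ⟨fun j => ?_, fun i j hij A hA => ?_⟩
  · exact @measurable_seqNorm X 𝕜 _ p (ℱ j) _ fun l => ((hf l).1 j).measurable
  · unfold seqNorm
    refine setLIntegral_tsum_rpow_le (ℱ.le i) (one_le_toReal_exponent hp hp_top) (hm i)
      (fun l => (hm j l).mono (ℱ.le j) le_rfl) (fun l B hB => ?_) hA
    refine le_trans (le_of_eq (lintegral_congr_ae (ae_restrict_of_ae ?_)))
      (setLIntegral_enorm_condExp_le (m := ℱ i) ((hf l).integrable j) hB)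
    filter_upwards [(hf l).2 i j hij] with x hx
    rw [hx]

variable [IsProbabilityMeasure μ]

/-- The tails of a bounded `ℓ^p`-valued martingale are uniformly small. -/
theorem exists_forall_lintegral_seqNorm_tail_le (hp : 1 ≤ p) (hp_top : p ≠ ∞)
    (hf : ∀ l, Martingale (fun j => f j l) ℱ μ)
    (hbdd : ⨆ j, ∫⁻ x, seqNorm p (fun l => f j l x) ∂μ ≠ ∞) {η : ℝ≥0∞} (hη : 0 < η) :
    ∃ n, ∀ j, ∫⁻ x, seqNorm p (fun l => f j (n + l) x) ∂μ ≤ η := by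
  have hr := one_le_toReal_exponent hp hp_top
  have hr0 : 0 < p.toReal := by linarith
  set C := ⨆ j, ∫⁻ x, seqNorm p (fun l => f j l x) ∂μ with hCdef
  have hjC : ∀ j, ∫⁻ x, seqNorm p (fun l => f j l x) ∂μ ≤ C := fun j => le_iSup
    (fun j => ∫⁻ x, seqNorm p (fun l => f j l x) ∂μ) j
  have hhead : ∀ n, IsSubmartingaleENNReal
      (fun j x => seqNorm p (fun l => if l < n then f j l x else 0)) ℱ μ := by
    intro n
    have := isSubmartingaleENNReal_seqNorm (μ := μ) (ℱ := ℱ)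
      (f := fun j l x => if l < n then f j l x else 0) hp hp_top fun l => by
        by_cases hl : l < n
        · simpa only [hl, if_true] using hf l
        · simp only [hl, if_false]
          exact martingale_zero 𝕜 ℱ μ
    exact this
  have htail : ∀ n, IsSubmartingaleENNReal (fun j x => seqNorm p (fun l => f j (n + l) x)) ℱ μ :=
    fun n => isSubmartingaleENNReal_seqNorm (f := fun j l => f j (n + l)) hp hp_top
      fun l => hf (n + l)
  have hmink : ∀ n j, (∫⁻ x, seqNorm p (fun l => if l < n then f j l x else 0) ∂μ) ^ p.toReal +
      (∫⁻ x, seqNorm p (fun l => f j (n + l) x) ∂μ) ^ p.toReal ≤ C ^ p.toReal := by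
    intro n j
    refine (lintegral_rpow_add_lintegral_rpow_le hr ((hhead n).measurable' j)
      ((htail n).measurable' j)).trans (ENNReal.rpow_le_rpow ?_ hr0.le)
    simp_rw [seqNorm_eq_head_tail hp hp_top]
    exact hjC j
  -- For `C = 0` no threshold lies strictly below `C`, so this case is treated apart.
  rcases eq_or_ne C 0 with hC0 | hC0
  · refine ⟨0, fun j => ?_⟩
    simp only [zero_add]
    exact ((hjC j).trans_eq hC0).trans zero_le
  have hCr0 : C ^ p.toReal ≠ 0 := by simp [hC0, hr0.not_gt]
  have hCrt : C ^ p.toReal ≠ ∞ := ENNReal.rpow_ne_top_of_nonneg hr0.le hbdd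
  have hηr : η ^ p.toReal ≠ 0 := by simp [hη.ne', hr0.not_gt]
  -- The threshold satisfies `c ^ p + η ^ p ≥ C ^ p`, even under truncated subtraction, so a head
  -- integral above `c` and a tail integral above `η` together contradict `hmink`.
  set c := (C ^ p.toReal - η ^ p.toReal) ^ (1 / p.toReal) with hc
  have hcr : c ^ p.toReal = C ^ p.toReal - η ^ p.toReal := by
    rw [hc, ← ENNReal.rpow_mul, one_div_mul_cancel hr0.ne', ENNReal.rpow_one]
  have hcC : c < C := by
    rw [← ENNReal.rpow_lt_rpow_iff hr0, hcr]
    exact ENNReal.sub_lt_self hCrt hCr0 hηr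
  obtain ⟨k, hk⟩ := lt_iSup_iff.1 hcC
  have hmono : ∀ x, Monotone fun n => seqNorm p (fun l => if l < n then f k l x else 0) := by
    intro x a b hab
    rw [← ENNReal.rpow_le_rpow_iff hr0, seqNorm_head_rpow hp hp_top (fun l => f k l x),
      seqNorm_head_rpow hp hp_top (fun l => f k l x)]
    exact Finset.sum_le_sum_of_subset (Finset.range_mono hab)
  have hsup : ∀ x, ⨆ n, seqNorm p (fun l => if l < n then f k l x else 0) =
      seqNorm p (fun l => f k l x) := by
    intro x
    refine (ENNReal.orderIsoRpow p.toReal hr0).injective ?_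
    rw [OrderIso.map_iSup]
    simp only [ENNReal.orderIsoRpow_apply]
    rw [seqNorm_rpow hp hp_top, ENNReal.tsum_eq_iSup_nat]
    exact iSup_congr fun n => seqNorm_head_rpow hp hp_top (fun l => f k l x) n
  -- Heads increase to the full norm, so at the fixed time `k` some finite head already exceeds `c`;
  -- the same `n` then works for all later times.
  obtain ⟨n, hn⟩ : ∃ n, c < ∫⁻ x, seqNorm p (fun l => if l < n then f k l x else 0) ∂μ := by
    rw [← lt_iSup_iff, ← lintegral_iSup (fun n => (hhead n).measurable' k)
      fun a b hab x => hmono x hab]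
    simpa only [hsup] using hk
  have hge : ∀ j, k ≤ j → ∫⁻ x, seqNorm p (fun l => f j (n + l) x) ∂μ ≤ η := by
    intro j hkj
    by_contra! hlt
    have h1 : C ^ p.toReal - η ^ p.toReal <
        (∫⁻ x, seqNorm p (fun l => if l < n then f j l x else 0) ∂μ) ^ p.toReal := by
      rw [← hcr]
      exact ENNReal.rpow_lt_rpow (hn.trans_le ((hhead n).lintegral_mono hkj)) hr0
    have h2 := ENNReal.rpow_lt_rpow hlt hr0
    exact (hmink n j).not_gt (tsub_le_iff_right.1 le_rfl |>.trans_lt (ENNReal.add_lt_add h1 h2))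
  refine ⟨n, fun j => ?_⟩
  rcases le_total k j with h | h
  · exact hge j h
  · exact ((htail n).lintegral_mono h).trans (hge k le_rfl)

/-- Almost everywhere convergence of bounded `ℓ^p`-valued martingales. -/
theorem ae_exists_tendstoInSeqLp_of_bounded (hp : 1 ≤ p) (hp_top : p ≠ ∞)
    (hf : ∀ l, Martingale (fun j => f j l) ℱ μ) {C : ℝ≥0}
    (hC : ∀ j, ∫⁻ x, seqNorm p (fun l => f j l x) ∂μ ≤ C) :
    ∀ᵐ x ∂μ, ∃ g : ℕ → 𝕜, TendstoInSeqLp p (fun j l => f j l x) g := by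
  have hbdd : ⨆ j, ∫⁻ x, seqNorm p (fun l => f j l x) ∂μ ≠ ∞ :=
    ne_top_of_le_ne_top ENNReal.coe_ne_top (iSup_le hC)
  have hN := isSubmartingaleENNReal_seqNorm (μ := μ) hp hp_top hf
  have hfin : ∀ᵐ x ∂μ, ∀ j, seqNorm p (fun l => f j l x) < ∞ := ae_all_iff.2 fun j =>
    ae_lt_top (hN.measurable' j) ((hC j).trans_lt ENNReal.coe_lt_top).ne
  have hcoord : ∀ᵐ x ∂μ, ∀ l, ∃ c, Tendsto (fun j => f j l x) atTop (𝓝 c) := by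
    refine ae_all_iff.2 fun l => ae_exists_tendsto_of_martingale (hf l) (R := C) fun j => ?_
    rw [eLpNorm_one_eq_lintegral_enorm]
    exact (lintegral_mono fun x => enorm_le_seqNorm hp hp_top (fun l => f j l x) l).trans (hC j)
  have htail : ∀ᵐ x ∂μ, ∀ k : ℕ, ∃ n, ∀ j,
      seqNorm p (fun l => f j (n + l) x) ≤ ((k : ℝ≥0∞) + 1)⁻¹ := by
    refine ae_all_iff.2 fun k => ?_
    rw [ae_iff]
    -- If no `n` works at `x`, then the supremum of the tails beyond any chosen `n` exceeds the
    -- level; the maximal inequality for the tail process bounds this event, with `η` arbitrary.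
    have hle : ∀ η : ℝ≥0∞, 0 < η → ((k : ℝ≥0∞) + 1)⁻¹ * μ {x | ¬∃ n, ∀ j,
        seqNorm p (fun l => f j (n + l) x) ≤ ((k : ℝ≥0∞) + 1)⁻¹} ≤ η := by
      intro η hη
      obtain ⟨n, hn⟩ := exists_forall_lintegral_seqNorm_tail_le hp hp_top hf hbdd hη
      have htn := isSubmartingaleENNReal_seqNorm (μ := μ) (ℱ := ℱ) (f := fun j l => f j (n + l))
        hp hp_top fun l => hf (n + l)
      refine le_trans ?_ ((htn.mul_measure_iSup_le ((k : ℝ≥0∞) + 1)⁻¹).trans (iSup_le hn))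
      gcongr
      intro hx
      simp only [not_exists, not_forall, not_le] at hx ⊢
      obtain ⟨j, hj⟩ := hx n
      exact lt_iSup_iff.2 ⟨j, hj⟩
    exact (mul_eq_zero.1 (le_antisymm (le_of_forall_gt_imp_ge_of_dense hle) zero_le)).resolve_left
      (by simp)
  filter_upwards [hfin, hcoord, htail] with x h1 h2 h3
  choose g hg using h2
  refine ⟨g, tendstoInSeqLp_of_tails hp hp_top h1 hg fun ε hε => ?_⟩
  obtain ⟨k, hk⟩ := ENNReal.exists_inv_nat_lt hε.ne'
  obtain ⟨n, hn⟩ := h3 k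
  refine ⟨n, fun j => (hn j).trans (le_trans ?_ hk.le)⟩
  exact ENNReal.inv_le_inv.2 le_self_add

end SeqMartingale

theorem mainTheorem6 {X Y 𝕜 : Type*} [RCLike 𝕜] [mX : MeasurableSpace X] [mY : MeasurableSpace Y]
    (μ : Measure X) [IsProbabilityMeasure μ] (ν : Measure Y) [IsProbabilityMeasure ν]
    (ℱ : Filtration ℕ mX) (p : ℝ≥0∞) (hp : 1 ≤ p) (hp_top : p ≠ ∞) :
    -- (1) martingales of conditional expectations, `1 ≤ p < ∞`
    (∀ F : X × Y → 𝕜, StronglyMeasurable F → mixedNorm p μ ν F < ∞ →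
      Integrable F (μ.prod ν) ∧
      (∀ j, ∀ᵐ x ∂μ, sliceNorm p ν ((μ.prod ν)[F | prodFiltration ℱ j]) x ≤
        ENNReal.ofReal ((μ[fun x' => (sliceNorm p ν F x').toReal | ℱ j]) x)) ∧
      (∀ j, mixedNorm p μ ν ((μ.prod ν)[F | prodFiltration ℱ j]) ≤ mixedNorm p μ ν F) ∧
      Tendsto (fun j => mixedNorm p μ ν
          ((μ.prod ν)[F | prodFiltration ℱ j] - (μ.prod ν)[F | ⨆ i, prodFiltration ℱ i]))
        atTop (𝓝 0) ∧
      (∀ᵐ x ∂μ, TendstoInLp p ν (fun j y => ((μ.prod ν)[F | prodFiltration ℱ j]) (x, y))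
        (fun y => ((μ.prod ν)[F | ⨆ i, prodFiltration ℱ i]) (x, y))) ∧
      (AEStronglyMeasurable[⨆ i, prodFiltration ℱ i] F (μ.prod ν) →
        Tendsto (fun j => mixedNorm p μ ν ((μ.prod ν)[F | prodFiltration ℱ j] - F))
          atTop (𝓝 0) ∧
        ∀ᵐ x ∂μ, TendstoInLp p ν (fun j y => ((μ.prod ν)[F | prodFiltration ℱ j]) (x, y))
          (fun y => F (x, y)))) ∧
    -- (2) submartingale inequality and maximal estimate, `1 ≤ p < ∞`
    (∀ F : ℕ → X × Y → 𝕜, Martingale F (prodFiltration ℱ) (μ.prod ν) →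
      (∀ j, mixedNorm p μ ν (F j) < ∞) →
      Submartingale (fun j x => (sliceNorm p ν (F j) x).toReal) ℱ μ ∧
      ∀ t : ℝ≥0, t * μ {x | (t : ℝ≥0∞) < ⨆ j, sliceNorm p ν (F j) x} ≤
        ⨆ j, mixedNorm p μ ν (F j)) ∧
    -- (3) convergence in the uniformly integrable case, `1 < p < ∞`
    (1 < p → ∀ F : ℕ → X × Y → 𝕜, Martingale F (prodFiltration ℱ) (μ.prod ν) →
      (∃ C : ℝ≥0, ∀ j, mixedNorm p μ ν (F j) ≤ C) →
      UniformIntegrable (fun j x => (sliceNorm p ν (F j) x).toReal) 1 μ →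
      UniformIntegrable F 1 (μ.prod ν) ∧
      ∃ G : X × Y → 𝕜, StronglyMeasurable G ∧ mixedNorm p μ ν G < ∞ ∧
        (∀ j, F j =ᵐ[μ.prod ν] (μ.prod ν)[G | prodFiltration ℱ j]) ∧
        Tendsto (fun j => eLpNorm (F j - G) 1 (μ.prod ν)) atTop (𝓝 0) ∧
        (∀ᵐ z ∂(μ.prod ν), Tendsto (fun j => F j z) atTop (𝓝 (G z))) ∧
        Tendsto (fun j => mixedNorm p μ ν (F j - G)) atTop (𝓝 0) ∧
        ∀ᵐ x ∂μ, TendstoInLp p ν (fun j y => F j (x, y)) (fun y => G (x, y))) ∧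
    -- (4) convergence for bounded mixed norms, `1 < p < ∞`
    (1 < p → ∀ F : ℕ → X × Y → 𝕜, Martingale F (prodFiltration ℱ) (μ.prod ν) →
      (∃ C : ℝ≥0, ∀ j, mixedNorm p μ ν (F j) ≤ C) →
      ∀ᵐ x ∂μ, ∃ g : Y → 𝕜, TendstoInLp p ν (fun j y => F j (x, y)) g) ∧
    -- (5) the sequence-space version, `1 ≤ p < ∞`
    (∀ f : ℕ → ℕ → X → 𝕜, (∀ l, Martingale (fun j => f j l) ℱ μ) →
      (∃ C : ℝ≥0, ∀ j, ∫⁻ x, seqNorm p (fun l => f j l x) ∂μ ≤ C) →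
      Submartingale (fun j x => (seqNorm p (fun l => f j l x)).toReal) ℱ μ ∧
      (∀ t : ℝ≥0, t * μ {x | (t : ℝ≥0∞) < ⨆ j, seqNorm p (fun l => f j l x)} ≤
        ⨆ j, ∫⁻ x, seqNorm p (fun l => f j l x) ∂μ) ∧
      (∀ η : ℝ≥0, 0 < η → ∃ n, ∀ j, ∫⁻ x, seqNorm p (fun l => f j (n + l) x) ∂μ ≤ η) ∧
      ∀ᵐ x ∂μ, ∃ g : ℕ → 𝕜, TendstoInSeqLp p (fun j l => f j l x) g) := by
  refine ⟨fun F hF hF_top => ?_, fun F hF hF_top => ?_, fun hp1 F hF hC hu => ?_,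
    fun hp1 F hF hC => ?_, fun f hf hC => ?_⟩
  · have hFi := integrable_of_mixedNorm_lt_top hp hF.measurable hF_top
    refine ⟨hFi, fun j => ?_, fun j => mixedNorm_condExp_le (ℱ.le j) hp hp_top hF.measurable hFi,
      mixedNorm_condExp_convergence ℱ hp hp_top hF.measurable hF_top⟩
    exact ae_le_ofReal_condExp_toReal (ℱ.le j)
      ((isSubmartingaleENNReal_sliceNorm hp hp_top (martingale_condExp F _ _)).measurable j)
      (measurable_sliceNorm hp hp_top hF.measurable) hF_top.ne
      fun A hA => setLIntegral_sliceNorm_condExp_le (ℱ.le j) hp hp_top hF.measurable hFi hA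
  · have hN := isSubmartingaleENNReal_sliceNorm hp hp_top hF
    exact ⟨hN.submartingale_toReal fun j => (hF_top j).ne, fun t => hN.mul_measure_iSup_le t⟩
  · obtain ⟨C, hC⟩ := hC
    exact mixedNorm_martingale_convergence hp1 hp_top hF hC hu
  · obtain ⟨C, hC⟩ := hC
    exact ae_exists_tendstoInLp_of_bounded hp1 hp_top hF hC
  · obtain ⟨C, hC⟩ := hC
    have hN := isSubmartingaleENNReal_seqNorm (μ := μ) hp hp_top hf
    refine ⟨hN.submartingale_toReal fun j => ((hC j).trans_lt ENNReal.coe_lt_top).ne,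
      fun t => hN.mul_measure_iSup_le t, fun η hη => ?_,
      ae_exists_tendstoInSeqLp_of_bounded hp hp_top hf hC⟩
    exact exists_forall_lintegral_seqNorm_tail_le hp hp_top hf
      (ne_top_of_le_ne_top ENNReal.coe_ne_top (iSup_le hC)) (by exact_mod_cast hη)
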